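/- A \emph{set-sequence equipped with embeddings} (ssee) $\mathbf V$ is a sequence $(V_n)_{n\in\mathbb N}$ of finite sets together with, for all $N\le n$, a collection $\binom{V_n}{V_N}$ of injections $\phi:V_N\to V_n$, called embeddings. Let $I(N,n)$ be the number of ordered pairs $(\phi,\psi)$ of embeddings in $\binom{V_n}{V_N}$ with $1<|\phi(V_N)\cap\psi(V_N)|<|V_N|$. The ssee $\mathbf V$ is \emph{good} if $|V_n|\to\infty$ and, for every $N$ with $|V_N|>1$, as $n\to\infty$ \[ \frac{\bigl|\binom{V_n}{V_N}\bigr|}{|V_n|}\to\infty \qquad\text{and}\qquad \frac{|V_n|\,I(N,n)}{\bigl|\binom{V_n}{V_N}\bigr|^2}\to 0 . \] It is \emph{homogeneous} if for all $N\le n$ with $V_N\neq\emptyset$ there is an integer $k>0$ such that every $x\in V_n$ belongs to $\phi(V_N)$ for exactly $k$ embeddings $\phi\in\binom{V_n}{V_N}$. A \emph{$[0,1]$-decoration property} of $\mathbf V$ is a sequence $\mathcal P=(\mathcal P_n)_{n\in\mathbb N}$ of Lebesgue measurable sets $\mathcal P_n\subseteq[0,1]^{V_n}$. It is \emph{hereditary}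 if for all $N\le n$, $\phi\in\binom{V_n}{V_N}$ and $c\in[0,1]^{V_n}$ with $c\circ\phi\notin\mathcal P_N$, one has $c\notin\mathcal P_n$. A \emph{box} in $V_n$ is a product $b=\prod_{i\in V_n}A_i$ of measurable sets $A_i\subseteq[0,1]$. Write $\mathrm{vol}$ for Lebesgue measure on $[0,1]^{V_n}$, and set \[ \mathrm{ex}(V_n,\mathcal P_n):=\inf\{-\log \mathrm{vol}(b)\;:\; b \text{ a box in } V_n,\ \mathrm{vol}(b\setminus\mathcal P_n)=0\}\in[0,\infty], \qquad -\log 0:=\infty . \] \textbf{Theorem.} Let $\mathbf V$ be a good homogeneous ssee and let $\mathcal P$ be a hereditary $[0,1]$-decoration property of $\mathbf V$. Then one of the following holds: \begin{enumerate} \item[(a)] the limit $\pi(\mathcal P)=\lim_{n\to\infty}\mathrm{ex}(V_n,\mathcal P_n)/|V_n|$ exists and is finite, and \[ \mathrm{vol}(\mathcal P_n)=e^{-(\pi(\mathcal P)+o(1))|V_n|}\quad\text{as } n\to\infty ; \] \item[(b)] $\mathrm{ex}(V_n,\mathcal P_n)/|V_n|\to\infty$ as $n\to\infty$, and $\mathrm{vol}(\mathcal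 P_n)\le e^{-\omega(|V_n|)}$; that is, there are reals $w_n$ with $w_n/|V_n|\to\infty$ and $\mathrm{vol}(\mathcal P_n)\le e^{-w_n}$ for all sufficiently large $n$. \end{enumerate} -/

import Mathlib

open Filter Topology MeasureTheory

universe u

/-- A set-sequence equipped with embeddings (ssee): finite sets `V 0, V 1, V 2, …` and, for `N ≤ n`,
a collection `emb N n` of injections from `V N` to `V n`.
(The collections `emb N n` with `n < N` play no role in what follows.) -/
structure SSEE where
  V : ℕ → Type u
  [fintypeV : ∀ n, Fintype (V n)]
  emb : ∀ N n : ℕ, Finset (V N ↪ V n)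

attribute [instance] SSEE.fintypeV

namespace SSEE

noncomputable section

/-- The number of `i`-intersecting embeddings of `(V N₁, V N₂)` into `V n`. A map on the disjoint
union `V N₁ ⊔ V N₂` is given by the pair of its restrictions to `V N₁` and `V N₂`. -/
def intersecting (S : SSEE.{u}) (i N₁ N₂ n : ℕ) : ℕ :=
  Set.ncard {p : (S.V N₁ ↪ S.V n) × (S.V N₂ ↪ S.V n) |
    p.1 ∈ S.emb N₁ n ∧ p.2 ∈ S.emb N₂ n ∧ (Set.range p.1 ∩ Set.range p.2).ncard = i}

/-- `I(N, n)`, the number of pairs of embeddings of `V N` into `V n` whose images share more than one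
and fewer than `|V N|` elements. -/
def totalIntersecting (S : SSEE.{u}) (N n : ℕ) : ℕ :=
  ∑ i ∈ Finset.Ioo 1 (Fintype.card (S.V N)), S.intersecting i N N n

structure IsGood (S : SSEE.{u}) : Prop where
  card_tendsto : Tendsto (fun n => Fintype.card (S.V n)) atTop atTop
  many_embeddings : ∀ N, 1 < Fintype.card (S.V N) →
    Tendsto (fun n => ((S.emb N n).card : ℝ) / (Fintype.card (S.V n) : ℝ)) atTop atTop
  few_intersections : ∀ N, 1 < Fintype.card (S.V N) →
    Tendsto (fun n => ((Fintype.card (S.V n) : ℝ) * (S.totalIntersecting N n : ℝ))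
      / ((S.emb N n).card : ℝ) ^ 2) atTop (𝓝 0)

/-- For `N ≤ n`, every element of `V n` lies in the image of the same, strictly positive number of
embeddings of `V N`. Indices `N` with `V N = ∅` are exempt: no element lies in the image of the
empty map. -/
def IsHomogeneous (S : SSEE.{u}) : Prop :=
  ∀ N n : ℕ, N ≤ n → Nonempty (S.V N) →
    ∃ k : ℕ, 0 < k ∧ ∀ x : S.V n, Set.ncard {φ | φ ∈ S.emb N n ∧ x ∈ Set.range φ} = k

/-- The set `[0,1]^(V n)` of `[0,1]`-decorations of `V n`; its `volume` is Lebesgue measure. -/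
abbrev Decoration (S : SSEE.{u}) (n : ℕ) : Type u := S.V n → unitInterval

/-- The `φ`-lift of a body `b ⊆ [0,1]^(V N)`. -/
def lift (S : SSEE.{u}) {N n : ℕ} (φ : S.V N ↪ S.V n) (b : Set (S.Decoration N)) :
    Set (S.Decoration n) :=
  {c | ∃ c' ∈ b, ∀ i, c' i = c (φ i)}

/-- The upper shadow in `[0,1]^(V n)` of a body `b ⊆ [0,1]^(V N)`. -/
def upperShadow (S : SSEE.{u}) {N : ℕ} (n : ℕ) (b : Set (S.Decoration N)) :
    Set (S.Decoration n) :=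
  ⋃ φ ∈ S.emb N n, S.lift φ b

/-- A `[0,1]`-decoration property: a sequence of Lebesgue measurable sets `P n ⊆ [0,1]^(V n)`.
(Null-measurable for `volume` is the same as Lebesgue measurable.) -/
structure DecorationProperty (S : SSEE.{u}) where
  body : ∀ n, Set (S.Decoration n)
  measurable_body : ∀ n, NullMeasurableSet (body n) volume

/-- The complement of a hereditary property is closed under taking upper shadows. -/
def DecorationProperty.IsHereditary {S : SSEE.{u}} (P : S.DecorationProperty) : Prop :=
  ∀ N n : ℕ, N ≤ n → S.upperShadow n (P.body N)ᶜ ⊆ (P.body n)ᶜ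

/-- Boxes: products of Lebesgue measurable subsets of `[0,1]`. -/
def boxes (S : SSEE.{u}) (n : ℕ) : Set (Set (S.Decoration n)) :=
  {b | ∃ A : S.V n → Set unitInterval,
    (∀ i, NullMeasurableSet (A i) volume) ∧ b = Set.univ.pi A}

/-- The entropy `-log vol(b)`, with value `+∞` when `vol(b) = 0`. -/
def entropy (S : SSEE.{u}) {n : ℕ} (b : Set (S.Decoration n)) : EReal :=
  -ENNReal.log (volume b)

/-- The extremal entropy `ex(V n, P n)`, an element of `[0, +∞]`. -/
def extremalEntropy (S : SSEE.{u}) (P : S.DecorationProperty) (n : ℕ) : EReal :=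
  sInf {e | ∃ b ∈ S.boxes n, volume (b \ P.body n) = 0 ∧ e = S.entropy b}

end

end SSEE

/-! Let r = |V_N|, and call the embeddings of V_N into V_n edges. A box almost contained in P_n has
volume at most vol(P_n), so the normalized entropy of P_n never exceeds ex(V_n, P_n)/|V_n|.
Everything rests on the converse, `eventually_volume_le`: if ex(V_N, P_N) > m and η > 0, then -log
vol(P_n) ≥ (m/r - η)|V_n| for all large n. Hence the limsup of ex(V_n, P_n)/|V_n| is at most the
liminf of the entropies, so both sequences share a limit, finite in case (a) and infinite in case
(b).

For the converse, discretize [0,1] into finitely many cells, the colours, so that P_N is nearly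
complementary to a set Q of colourings of V_N. By compactness (`exists_pos_forall_box_lt`) even
boxes containing little of Q have volume below e^{-m}. Take a uniform point of P_n and let μ be the
law of its colouring. By heredity all its edges lie in P_N, so an edge is coloured from Q only
through the discretization error; Finner's inequality makes the expected proportion of such edges
small, unless vol(P_n) is already small enough (`sum_sum_cellLaw_le`).

An energy increment argument (`exists_pinning_set`) gives a small set F of vertices such that, given
the colours on F, the colours along a typical edge are nearly independent. Goodness enters here: it
says that pairs of edges sharing more than one vertex are negligible in a second moment.

Given F, the container of a vertex outside F is the set of its colours of conditional density at
least θ. If the containers along an edge that avoids F held much of Q, near independence would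
colour that edge from Q with noticeable probability. So for most edges this box contains little of
Q, and the entropies of its containers add up to at least m. Double counting over the regular family
of edges gives total container entropy close to m|V_n|/r, and Gibbs' inequality
(`sum_mul_log_density_le`) turns this into a lower bound for -log vol(P_n). -/

/-! ### Finner's inequality for regular covers. -/

section Finner

open scoped ENNReal

variable {ι δ : Type*} [DecidableEq δ] {X : Type*} [MeasurableSpace X]
  {μ : Measure X} [IsProbabilityMeasure μ]

/-- Partial integration form of Finner's inequality, for a uniform cover of the coordinates. -/
theorem lmarginal_prod_rpow_le (E : Finset ι) (S : ι → Finset δ)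
    {f : ι → (δ → X) → ℝ≥0∞} (hf : ∀ i, Measurable (f i))
    (hdep : ∀ i v, v ∉ S i → ∀ x y, f i (Function.update x v y) = f i x)
    {k : ℕ} (hk : 0 < k) (hdeg : ∀ v, (E.filter (fun i => v ∈ S i)).card = k)
    (s : Finset δ) (x : δ → X) :
    (∫⋯∫⁻_s, (fun x => ∏ i ∈ E, f i x ^ (1 / k : ℝ)) ∂(fun _ => μ)) x ≤
      ∏ i ∈ E, ((∫⋯∫⁻_s, f i ∂(fun _ => μ)) x) ^ (1 / k : ℝ) := by
  have hmeas : Measurable (fun x => ∏ i ∈ E, f i x ^ (1 / k : ℝ)) :=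
    Finset.measurable_prod _ fun i _ => (hf i).pow_const _
  induction s using Finset.induction generalizing x with
  | empty => simp
  | insert v s hv ih =>
    have hconst : ∀ i, v ∉ S i → ∀ t, (∫⋯∫⁻_s, f i ∂(fun _ => μ)) (Function.update x v t)
        = (∫⋯∫⁻_s, f i ∂(fun _ => μ)) x := by
      intro i hi t
      rw [lmarginal_update_of_notMem (hf i) hv]
      congr 1
      ext y
      exact hdep i v hi y t
    rw [lmarginal_insert _ hmeas hv]
    have hins : ∀ i, (∫⋯∫⁻_insert v s, f i ∂(fun _ => μ)) x =
        ∫⁻ t, (∫⋯∫⁻_s, f i ∂(fun _ => μ)) (Function.update x v t) ∂μ :=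
      fun i => lmarginal_insert _ (hf i) hv x
    have hm : ∀ i, Measurable
        (fun t => (∫⋯∫⁻_s, f i ∂(fun _ => μ)) (Function.update x v t)) :=
      fun i => ((hf i).lmarginal (fun _ => μ)).comp (measurable_update x)
    calc _ ≤ ∫⁻ t, ∏ i ∈ E,
            ((∫⋯∫⁻_s, f i ∂(fun _ => μ)) (Function.update x v t)) ^ (1 / k : ℝ) ∂μ :=
          lintegral_mono fun t => ih _
      _ = ∫⁻ t, (∏ i ∈ E.filter (fun i => v ∈ S i),
            ((∫⋯∫⁻_s, f i ∂(fun _ => μ)) (Function.update x v t)) ^ (1 / k : ℝ)) *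
            ∏ i ∈ E.filter (fun i => v ∉ S i),
            ((∫⋯∫⁻_s, f i ∂(fun _ => μ)) x) ^ (1 / k : ℝ) ∂μ := by
          refine lintegral_congr fun t => ?_
          rw [← Finset.prod_filter_mul_prod_filter_not E (fun i => v ∈ S i)]
          congr 1
          refine Finset.prod_congr rfl fun i hi => ?_
          rw [hconst i (Finset.mem_filter.1 hi).2 t]
      _ = (∫⁻ t, ∏ i ∈ E.filter (fun i => v ∈ S i),
            ((∫⋯∫⁻_s, f i ∂(fun _ => μ)) (Function.update x v t)) ^ (1 / k : ℝ) ∂μ) *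
            ∏ i ∈ E.filter (fun i => v ∉ S i),
            ((∫⋯∫⁻_s, f i ∂(fun _ => μ)) x) ^ (1 / k : ℝ) :=
          lintegral_mul_const _ (Finset.measurable_prod _ fun i _ => (hm i).pow_const _)
      _ ≤ (∏ i ∈ E.filter (fun i => v ∈ S i),
            (∫⁻ t, (∫⋯∫⁻_s, f i ∂(fun _ => μ)) (Function.update x v t) ∂μ) ^ (1 / k : ℝ)) *
            ∏ i ∈ E.filter (fun i => v ∉ S i),
            ((∫⋯∫⁻_s, f i ∂(fun _ => μ)) x) ^ (1 / k : ℝ) := by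
          gcongr
          -- Hölder in the single coordinate v: exactly k factors depend on it, so their exponents
          -- 1/k sum to one. The remaining factors were pulled out as constants.
          refine ENNReal.lintegral_prod_norm_pow_le (p := fun _ => (1 / k : ℝ)) _
            (fun i _ => (hm i).aemeasurable) ?_ (fun _ _ => by positivity)
          have : (k : ℝ) ≠ 0 := by positivity
          simp [hdeg v, this]
      _ = _ := by
          rw [← Finset.prod_filter_mul_prod_filter_not E (fun i => v ∈ S i)]
          congr 1
          · exact Finset.prod_congr rfl fun i _ => by rw [hins]
          · refine Finset.prod_congr rfl fun i hi => ?_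
            rw [hins]
            simp [hconst i (Finset.mem_filter.1 hi).2]

/-- Finner's inequality for a uniform cover of the coordinates. -/
theorem lintegral_prod_rpow_le_of_cover [Fintype δ] (E : Finset ι) (S : ι → Finset δ)
    {f : ι → (δ → X) → ℝ≥0∞} (hf : ∀ i, Measurable (f i))
    (hdep : ∀ i v, v ∉ S i → ∀ x y, f i (Function.update x v y) = f i x)
    {k : ℕ} (hk : 0 < k) (hdeg : ∀ v, (E.filter (fun i => v ∈ S i)).card = k) :
    ∫⁻ x, ∏ i ∈ E, f i x ^ (1 / k : ℝ) ∂(Measure.pi fun _ : δ => μ) ≤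
      ∏ i ∈ E, (∫⁻ x, f i x ∂(Measure.pi fun _ : δ => μ)) ^ (1 / k : ℝ) := by
  have : Nonempty X := nonempty_of_isProbabilityMeasure μ
  let x : δ → X := fun _ => Classical.arbitrary X
  have := lmarginal_prod_rpow_le (μ := μ) E S hf hdep hk hdeg Finset.univ x
  simpa using this

end Finner

/-! ### Setwise limits of dominated measures. -/

section LimitMeasure

open scoped ENNReal

/-- A sequence of measures dominated by a finite measure converges setwise along an ultrafilter. -/
theorem exists_measure_tendsto_ultrafilter {Ω : Type*} [MeasurableSpace Ω] (m : Measure Ω)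
    [IsFiniteMeasure m] (ν : ℕ → Measure Ω) (h : ∀ j, ν j ≤ m) (U : Ultrafilter ℕ) :
    ∃ ρ : Measure Ω, ρ ≤ m ∧
      ∀ C, MeasurableSet C → Tendsto (fun j => ν j C) U (𝓝 (ρ C)) := by
  -- Compactness of [0, ∞] gives a limit along the ultrafilter for every set at once, with no
  -- subsequence to extract.
  have hlim : ∀ C : Set Ω, ∃ a, Tendsto (fun j => ν j C) U (𝓝 a) := fun C =>
    ⟨_, (U.map (fun j => ν j C)).le_nhds_lim⟩
  choose r hr using hlim
  have hrm : ∀ C, r C ≤ m C := fun C =>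
    le_of_tendsto (hr C) (Eventually.of_forall fun j => h j C)
  let ρ : Measure Ω := Measure.ofMeasurable (fun C _ => r C)
    (le_antisymm (by simpa using hrm ∅) bot_le) (by
      intro C hC hd
      have hsum : Summable fun i => (m (C i)).toReal := by
        refine ENNReal.summable_toReal ?_
        rw [← measure_iUnion hd hC]
        exact measure_ne_top _ _
      have hfin : ∀ j s, ν j s ≠ ∞ := fun j s =>
        ((h j s).trans_lt (measure_lt_top m s)).ne
      have hrfin : ∀ s, r s ≠ ∞ := fun s => ((hrm s).trans_lt (measure_lt_top m s)).ne
      -- Countable additivity survives the limit because the summable sequence m (C i) dominates.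
      have ht : Tendsto (fun j => ∑' i, (ν j (C i)).toReal) U
          (𝓝 (∑' i, (r (C i)).toReal)) := by
        refine tendsto_tsum_of_dominated_convergence hsum
          (fun i => (ENNReal.tendsto_toReal (hrfin _)).comp (hr (C i)))
          (Eventually.of_forall fun j i => ?_)
        rw [Real.norm_of_nonneg ENNReal.toReal_nonneg]
        exact ENNReal.toReal_mono (measure_ne_top _ _) (h j _)
      have ht' : Tendsto (fun j => (ν j (⋃ i, C i)).toReal) U
          (𝓝 (r (⋃ i, C i)).toReal) :=
        (ENNReal.tendsto_toReal (hrfin _)).comp (hr _)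
      have heq : ∀ j, (ν j (⋃ i, C i)).toReal = ∑' i, (ν j (C i)).toReal := fun j => by
        rw [measure_iUnion hd hC, ENNReal.tsum_toReal_eq (fun i => hfin j _)]
      simp only [heq] at ht'
      have key := tendsto_nhds_unique ht' ht
      rw [← ENNReal.tsum_toReal_eq (fun i => hrfin _)] at key
      refine (ENNReal.toReal_eq_toReal_iff' (hrfin _) ?_).1 key
      refine ((ENNReal.tsum_le_tsum fun i => hrm (C i)).trans_lt ?_).ne
      rw [← measure_iUnion hd hC]
      exact measure_lt_top _ _)
  have hρ : ∀ C, MeasurableSet C → ρ C = r C := fun C hC => Measure.ofMeasurable_apply C hC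
  refine ⟨ρ, Measure.le_iff.2 fun C hC => (hρ C hC).trans_le (hrm C), fun C hC => ?_⟩
  rw [hρ C hC]
  exact hr C

end LimitMeasure

/-! ### Stability of the box extremal problem under small errors. -/

section Robust

open scoped ENNReal

variable {ι X : Type*} [Fintype ι] [MeasurableSpace X] {μ : Measure X} [IsProbabilityMeasure μ]

/-- A product measure is determined by its values on boxes; there the integral of the product
density factors because the coordinates are independent. -/
theorem pi_withDensity_eq {w : ι → X → ℝ≥0∞} (hw : ∀ i, Measurable (w i))
    [∀ i, IsFiniteMeasure (μ.withDensity (w i))] :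
    Measure.pi (fun i => μ.withDensity (w i)) =
      (Measure.pi fun _ : ι => μ).withDensity (fun x => ∏ i, w i (x i)) := by
  refine Measure.pi_eq fun s hs => ?_
  have hind : ∀ x : ι → X, (Set.univ.pi s).indicator (fun x => ∏ i, w i (x i)) x =
      ∏ i, (s i).indicator (w i) (x i) := by
    intro x
    by_cases hx : x ∈ Set.univ.pi s
    · rw [Set.indicator_of_mem hx]
      exact Finset.prod_congr rfl fun i _ =>
        (Set.indicator_of_mem (hx i (Set.mem_univ i)) _).symm
    · rw [Set.indicator_of_notMem hx]
      simp only [Set.mem_pi, Set.mem_univ, true_imp_iff, not_forall] at hx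
      obtain ⟨i, hi⟩ := hx
      exact (Finset.prod_eq_zero (Finset.mem_univ i) (Set.indicator_of_notMem hi _)).symm
  have hm : ∀ i, Measurable ((s i).indicator (w i)) := fun i => (hw i).indicator (hs i)
  have hindep := ProbabilityTheory.iIndepFun_pi (μ := fun _ : ι => μ)
    (fun i => (hm i).aemeasurable)
  rw [withDensity_apply _ (MeasurableSet.univ_pi hs),
    ← lintegral_indicator (MeasurableSet.univ_pi hs)]
  simp only [hind]
  rw [ProbabilityTheory.lintegral_prod_eq_prod_lintegral_of_indepFun Finset.univ _ hindep
    (fun i => (hm i).comp (measurable_pi_apply i))]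
  refine Finset.prod_congr rfl fun i _ => ?_
  rw [withDensity_apply _ (hs i), ← lintegral_indicator (hs i)]
  exact (measurePreserving_eval (fun _ : ι => μ) i).lintegral_comp (hm i)

/-- If every box almost contained in `P` has measure less than `t`, then so does every box that is
contained in `P` up to a sufficiently small error. -/
theorem exists_pos_forall_box_lt {P : Set (ι → X)}
    (hP : NullMeasurableSet P (Measure.pi fun _ : ι => μ)) {t : ℝ≥0∞}
    (h : ∀ A : ι → Set X, (∀ i, MeasurableSet (A i)) →
      Measure.pi (fun _ : ι => μ) (Set.univ.pi A \ P) = 0 →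
      Measure.pi (fun _ : ι => μ) (Set.univ.pi A) < t) :
    ∃ κ : ℝ, 0 < κ ∧ ∀ A : ι → Set X, (∀ i, MeasurableSet (A i)) →
      Measure.pi (fun _ : ι => μ) (Set.univ.pi A \ P) ≤ ENNReal.ofReal κ →
      Measure.pi (fun _ : ι => μ) (Set.univ.pi A) < t := by
  set m := Measure.pi fun _ : ι => μ with hm
  by_contra! hcon
  -- Counterexamples with error tending to zero. Their sides are followed to a limit as restricted
  -- measures, since limits of indicators are in general densities rather than sets.
  have hseq : ∀ j : ℕ, ∃ A : ι → Set X, (∀ i, MeasurableSet (A i)) ∧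
      m (Set.univ.pi A \ P) ≤ ENNReal.ofReal (1 / ((j : ℝ) + 1)) ∧ t ≤ m (Set.univ.pi A) :=
    fun j => hcon _ (by positivity)
  choose A hA hAP hAt using hseq
  obtain ⟨B, hBP, hBm, hB⟩ := hP.exists_measurable_superset_ae_eq
  let U : Ultrafilter ℕ := hyperfilter ℕ
  have hU : (U : Filter ℕ) ≤ atTop := Nat.hyperfilter_le_atTop
  choose ρ hρμ hρ using fun i => exists_measure_tendsto_ultrafilter μ
    (fun j => μ.restrict (A j i)) (fun j => Measure.restrict_le_self) U
  obtain ⟨σ, hσm, hσ⟩ := exists_measure_tendsto_ultrafilter m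
    (fun j => m.restrict (Set.univ.pi (A j))) (fun j => Measure.restrict_le_self) U
  have hfin : ∀ i, IsFiniteMeasure (ρ i) := fun i => isFiniteMeasure_of_le μ (hρμ i)
  have hpi : Measure.pi ρ = σ := by
    refine Measure.pi_eq fun s hs => ?_
    refine tendsto_nhds_unique (hσ _ (MeasurableSet.univ_pi hs)) ?_
    have : ∀ j, (m.restrict (Set.univ.pi (A j))) (Set.univ.pi s) =
        ∏ i, μ.restrict (A j i) (s i) := fun j => by
      rw [hm, Measure.restrict_pi_pi, Measure.pi_pi]
    simp only [this]
    refine ENNReal.tendsto_finsetProd_of_ne_top _ (fun i _ => hρ i _ (hs i)) (fun i _ => ?_)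
    exact measure_ne_top _ _
  let w : ι → X → ℝ≥0∞ := fun i => (ρ i).rnDeriv μ
  have hw : ∀ i, Measurable (w i) := fun i => Measure.measurable_rnDeriv _ _
  have hρw : ∀ i, μ.withDensity (w i) = ρ i := fun i =>
    Measure.withDensity_rnDeriv_eq _ _ (Measure.absolutelyContinuous_of_le (hρμ i))
  have hσB : σ Bᶜ = 0 := by
    refine tendsto_nhds_unique (hσ _ hBm.compl) ?_
    refine tendsto_of_tendsto_of_tendsto_of_le_of_le tendsto_const_nhds (g := fun _ => 0)
      (h := fun j : ℕ => ENNReal.ofReal (1 / ((j : ℝ) + 1))) ?_ (fun _ => bot_le) (fun j => ?_)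
    · have := ENNReal.tendsto_ofReal (tendsto_one_div_add_atTop_nhds_zero_nat (𝕜 := ℝ))
      simpa using this.mono_left hU
    · refine le_trans ?_ (hAP j)
      rw [Measure.restrict_apply hBm.compl]
      refine measure_mono ?_
      rintro x ⟨hx, hx'⟩
      exact ⟨hx', fun hxP => hx (hBP hxP)⟩
  have hfin' : ∀ i, IsFiniteMeasure (μ.withDensity (w i)) := fun i => by
    rw [hρw]; exact hfin i
  have hσw : σ = m.withDensity (fun x => ∏ i, w i (x i)) := by
    rw [← hpi, ← pi_withDensity_eq hw]
    congr 1
    ext1 i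
    exact (hρw i).symm
  -- The supports of the limit densities form the limiting box. The product density is positive on
  -- it and its measure vanishes off B, so the box is almost inside P. As each density is at most
  -- one, passing to supports does not lose volume.
  let D : ι → Set X := fun i => {x | 0 < w i x}
  have hD : ∀ i, MeasurableSet (D i) := fun i => measurableSet_lt measurable_const (hw i)
  have hprodm : Measurable (fun x : ι → X => ∏ i, w i (x i)) :=
    Finset.measurable_prod _ fun i _ => (hw i).comp (measurable_pi_apply i)
  have hDP : m (Set.univ.pi D \ P) = 0 := by
    have h1 : m (Set.univ.pi D \ B) = 0 := by
      rw [hσw, withDensity_apply_eq_zero hprodm] at hσB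
      refine measure_mono_null ?_ hσB
      rintro x ⟨hx, hxB⟩
      refine ⟨?_, hxB⟩
      exact Finset.prod_ne_zero_iff.2 fun i _ => (hx i (Set.mem_univ i)).ne'
    refine measure_mono_null (t := (Set.univ.pi D \ B) ∪ (B \ P)) ?_
      (measure_union_null h1 (ae_le_set.1 hB.le))
    intro x hx
    by_cases hxB : x ∈ B
    · exact Or.inr ⟨hxB, hx.2⟩
    · exact Or.inl ⟨hx.1, hxB⟩
  refine absurd (h D hD hDP) (not_lt.2 ?_)
  have ht : t ≤ σ Set.univ :=
    ge_of_tendsto (hσ _ MeasurableSet.univ) (Eventually.of_forall fun j => by simpa using hAt j)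
  refine ht.trans ?_
  rw [← hpi, ← Set.pi_univ Set.univ, Measure.pi_pi, hm, Measure.pi_pi]
  refine Finset.prod_le_prod' fun i _ => ?_
  have h0 : ρ i (D i)ᶜ = 0 := by
    rw [← hρw i, withDensity_apply_eq_zero (hw i)]
    convert measure_empty (μ := μ) using 2
    ext x
    simp [D, pos_iff_ne_zero]
  calc ρ i Set.univ ≤ ρ i (D i) + ρ i (D i)ᶜ := by
        rw [← Set.union_compl_self (D i)]; exact measure_union_le _ _
    _ = ρ i (D i) := by rw [h0, add_zero]
    _ ≤ μ (D i) := hρμ i _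

end Robust

/-! ### Approximation by finitely many cells. -/

section FiniteApprox

open scoped ENNReal symmDiff

variable {ι X : Type*} [Fintype ι] [MeasurableSpace X]

/-- Measurable sets in a finite power can be approximated by unions of cells of a product of finite
partitions of the factor. -/
theorem exists_finite_partition_approx (m : Measure (ι → X)) [IsFiniteMeasure m]
    {P : Set (ι → X)} (hP : NullMeasurableSet P m) {ε : ℝ≥0∞} (hε : 0 < ε) :
    ∃ (K : Type) (_ : Fintype K) (q : X → K) (Q : Set (ι → K)),
      (∀ a, MeasurableSet (q ⁻¹' {a})) ∧ m ({x | q ∘ x ∈ Q} ∆ P) < ε := by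
  classical
  let C : Set (Set (ι → X)) := {T | ∃ (K : Type) (_ : Fintype K) (q : X → K) (Q : Set (ι → K)),
    (∀ a, MeasurableSet (q ⁻¹' {a})) ∧ T = {x | q ∘ x ∈ Q}}
  -- The common refinement K × K' of two partitions handles every Boolean operation.
  have hop : ∀ op : Prop → Prop → Prop, ∀ s ∈ C, ∀ t ∈ C, {x | op (x ∈ s) (x ∈ t)} ∈ C := by
    rintro op s ⟨K, _, q, Q, hq, rfl⟩ t ⟨K', _, q', Q', hq', rfl⟩
    refine ⟨K × K', inferInstance, fun x => (q x, q' x),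
      {y | op (Prod.fst ∘ y ∈ Q) (Prod.snd ∘ y ∈ Q')}, fun a => ?_, rfl⟩
    convert (hq a.1).inter (hq' a.2) using 1
    ext x
    simp [Prod.ext_iff]
  have hCm : ∀ s ∈ C, MeasurableSet s := by
    rintro s ⟨K, _, q, Q, hq, rfl⟩
    have : {x : ι → X | q ∘ x ∈ Q} = ⋃ y ∈ Q, ⋂ i, (fun x : ι → X => x i) ⁻¹' (q ⁻¹' {y i}) := by
      ext x
      simp only [Set.mem_ofPred_eq, Set.mem_iUnion, Set.mem_iInter, Set.mem_preimage,
        Set.mem_singleton_iff, exists_prop]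
      constructor
      · intro h
        exact ⟨_, h, fun i => rfl⟩
      · rintro ⟨y, hy, h⟩
        rwa [show q ∘ x = y from funext h]
    rw [this]
    exact MeasurableSet.biUnion (Set.to_countable Q) fun y _ =>
      MeasurableSet.iInter fun i => measurable_pi_apply i (hq (y i))
  have hempty : ∅ ∈ C :=
    ⟨Unit, inferInstance, fun _ => (), ∅, fun a => by simp, by simp⟩
  have huniv : Set.univ ∈ C :=
    ⟨Unit, inferInstance, fun _ => (), Set.univ, fun a => by simp, by simp⟩
  have hring : IsSetRing C :=
    { empty_mem := hempty
      union_mem := fun s t hs ht => hop Or s hs t ht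
      sdiff_mem := fun s t hs ht => hop (fun a b => a ∧ ¬ b) s hs t ht }
  have hgen : (inferInstance : MeasurableSpace (ι → X)) = MeasurableSpace.generateFrom C := by
    refine le_antisymm ?_ (MeasurableSpace.generateFrom_le hCm)
    refine iSup_le fun i => ?_
    rintro _ ⟨s, hs, rfl⟩
    refine MeasurableSpace.measurableSet_generateFrom
      -- A cylinder needs only the two-cell partition given by membership in s, with `Prop` as the
      -- colour set.
      ⟨Prop, inferInstance, fun x => x ∈ s, {y | y i}, fun a => ?_, rfl⟩
    exact measurableSet_setOfPred.1 (measurableSet_setOfPred.2 hs.mem) trivial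
  obtain ⟨B, hBm, hB⟩ := hP
  obtain ⟨t, ⟨K, _, q, Q, hq, rfl⟩, ht⟩ := exists_measure_symmDiff_lt_of_generateFrom_isSetRing
    (μ := m) hring ⟨{Set.univ}, by simp, by simpa using huniv, by simp⟩ hgen hBm hε
  refine ⟨K, inferInstance, q, Q, hq, ?_⟩
  rwa [measure_congr ((ae_eq_refl _).symmDiff hB)]

end FiniteApprox

/-! ### Double counting in regular families and the pinning lemma. -/

section Pinning

open Finset

variable {U V : Type*} [Fintype U] [DecidableEq U] [DecidableEq V]

theorem sum_ite_apply_eq (φ : U ↪ V) (v : V) :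
    (∑ i, if φ i = v then (1 : ℝ) else 0) = if ∃ i, φ i = v then 1 else 0 := by
  by_cases h : ∃ i, φ i = v
  · obtain ⟨i, rfl⟩ := h
    simp [φ.injective.eq_iff]
  · rw [if_neg h]
    push Not at h
    simp [h]

theorem card_filter_map_eq_le (E : Finset (U ↪ V)) (φ : U ↪ V) :
    (E.filter fun ψ => Fintype.card U ≤ (univ.map φ ∩ univ.map ψ).card).card ≤
      Fintype.card U ^ Fintype.card U := by
  have hr : Fintype.card (U → U) = Fintype.card U ^ Fintype.card U := by simp
  have hmem : ∀ ψ ∈ E.filter fun ψ => Fintype.card U ≤ (univ.map φ ∩ univ.map ψ).card,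
      ∀ i, ∃ j, φ j = ψ i := by
    intro ψ hψ i
    have h := (mem_filter.1 hψ).2
    have heq : univ.map φ ∩ univ.map ψ = univ.map ψ :=
      Finset.eq_of_subset_of_card_le inter_subset_right (by simpa using h)
    have : ψ i ∈ univ.map φ ∩ univ.map ψ := by rw [heq]; simp
    simpa using (mem_inter.1 this).1
  rw [← hr, ← Finset.card_univ]
  refine Finset.card_le_card_of_injOn
    -- An embedding with the same image as φ differs from it by a self-map of U, hence the bound
    -- r^r. The default value `i` is never used on the filtered family.
    (fun ψ i => if h : ∃ j, φ j = ψ i then h.choose else i) (by simp) ?_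
  intro ψ hψ ψ' hψ' heq
  ext i
  have h1 := hmem ψ hψ i
  have h2 := hmem ψ' hψ' i
  have := congrFun heq i
  simp only [dif_pos h1, dif_pos h2] at this
  rw [← h1.choose_spec, ← h2.choose_spec, this]

theorem sum_sum_ite_apply_eq {E : Finset (U ↪ V)} {k : ℕ}
    (hdeg : ∀ v, (E.filter (fun φ => ∃ i, φ i = v)).card = k) (v : V) :
    (∑ φ ∈ E, ∑ i, if φ i = v then (1 : ℝ) else 0) = k := by
  simp only [sum_ite_apply_eq]
  rw [← hdeg v, Finset.sum_boole]

variable [Fintype V]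

/-- Double counting of incidences. -/
theorem sum_sum_apply_eq {E : Finset (U ↪ V)} {k : ℕ}
    (hdeg : ∀ v, (E.filter (fun φ => ∃ i, φ i = v)).card = k) (s : V → ℝ) :
    ∑ φ ∈ E, ∑ i, s (φ i) = k * ∑ v, s v := by
  have h1 : ∀ φ : U ↪ V, ∀ i, s (φ i) = ∑ v, (if φ i = v then (1 : ℝ) else 0) * s v := by
    intro φ i
    simp
  have h2 : k * ∑ v, s v =
      ∑ v, ∑ φ ∈ E, ∑ i, (if φ i = v then (1 : ℝ) else 0) * s v := by
    rw [Finset.mul_sum]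
    refine Finset.sum_congr rfl fun v _ => ?_
    rw [← sum_sum_ite_apply_eq hdeg v]
    simp only [Finset.sum_mul]
  rw [h2]
  calc _ = ∑ φ ∈ E, ∑ i, ∑ v, (if φ i = v then (1 : ℝ) else 0) * s v :=
        Finset.sum_congr rfl fun φ _ => Finset.sum_congr rfl fun i _ => h1 φ i
    _ = ∑ φ ∈ E, ∑ v, ∑ i, (if φ i = v then (1 : ℝ) else 0) * s v :=
        Finset.sum_congr rfl fun φ _ => Finset.sum_comm
    _ = _ := Finset.sum_comm

theorem card_mul_card_eq {E : Finset (U ↪ V)} {k : ℕ}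
    (hdeg : ∀ v, (E.filter (fun φ => ∃ i, φ i = v)).card = k) :
    (Fintype.card U : ℝ) * E.card = k * Fintype.card V := by
  have := sum_sum_apply_eq hdeg (fun _ => 1)
  simpa [mul_comm] using this

/-- For uniform ρ, the zero set of ρ is a random subset containing each vertex independently with
probability 1/(M+1). Counting functions instead of weighting subsets keeps all sums uniform. -/
theorem sum_forall_mem_eq_zero (M : ℕ) (S : Finset V) :
    (∑ ρ : V → Fin (M + 1), if ∀ v ∈ S, ρ v = 0 then (1 : ℝ) else 0) =
      (M + 1 : ℝ) ^ Fintype.card V * ((M + 1 : ℝ)⁻¹) ^ S.card := by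
  rw [Finset.sum_boole]
  have : (univ.filter fun ρ : V → Fin (M + 1) => ∀ v ∈ S, ρ v = 0) =
      Fintype.piFinset (fun v => if v ∈ S then {0} else univ) := by
    ext ρ
    simp only [mem_filter, mem_univ, true_and, Fintype.mem_piFinset]
    refine forall_congr' fun v => ?_
    by_cases hv : v ∈ S <;> simp [hv]
  rw [this, Fintype.card_piFinset]
  have h2 : ∀ v, (if v ∈ S then ({0} : Finset (Fin (M + 1))) else univ).card =
      if v ∈ S then 1 else M + 1 := by
    intro v; split_ifs <;> simp
  simp only [h2]
  push_cast
  have h3 : ∀ v, (if v ∈ S then (1 : ℝ) else M + 1) =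
      (M + 1 : ℝ) * (if v ∈ S then (M + 1 : ℝ)⁻¹ else 1) := by
    intro v
    split_ifs
    · field_simp
    · simp
  simp only [h3, Finset.prod_mul_distrib]
  simp [Finset.prod_ite_mem]

/-- Second moment of the number of edges at v whose other vertices all fall in the random zero set.
Two edges meeting only at v have disjoint remainders, whence the factor q^(2(r-1)). Pairs with
larger intersection are counted trivially: proper overlaps are the pairs controlled by goodness, and
each edge has at most r^r edges with the same image. -/
theorem sum_sq_incidence_le {E : Finset (U ↪ V)} {k : ℕ}
    (hdeg : ∀ v, (E.filter (fun φ => ∃ i, φ i = v)).card = k) (M : ℕ) :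
    ∑ ρ : V → Fin (M + 1), ∑ v, (∑ φ ∈ E, ∑ i,
        if φ i = v ∧ ∀ x ∈ (univ.erase i).map φ, ρ x = 0 then (1 : ℝ) else 0) ^ 2 ≤
      (M + 1 : ℝ) ^ Fintype.card V *
        ((k : ℝ) ^ 2 * Fintype.card V * ((M + 1 : ℝ)⁻¹) ^ (2 * (Fintype.card U - 1)) +
          Fintype.card U * (((E ×ˢ E).filter fun p => 1 < (univ.map p.1 ∩ univ.map p.2).card ∧
              (univ.map p.1 ∩ univ.map p.2).card < Fintype.card U).card +
            E.card * (Fintype.card U : ℝ) ^ Fintype.card U)) := by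
  set r := Fintype.card U with hr
  set q : ℝ := (M + 1 : ℝ)⁻¹ with hq
  have hq0 : 0 ≤ q := by positivity
  have hq1 : q ≤ 1 := inv_le_one_of_one_le₀ (by linarith [(Nat.cast_nonneg M : (0:ℝ) ≤ M)])
  let e : (U ↪ V) → U → Finset V := fun φ i => (univ.erase i).map φ
  have hexp : ∀ ρ : V → Fin (M + 1), ∑ v, (∑ φ ∈ E, ∑ i,
        if φ i = v ∧ ∀ x ∈ e φ i, ρ x = 0 then (1 : ℝ) else 0) ^ 2 =
      ∑ φ ∈ E, ∑ ψ ∈ E, ∑ i, ∑ j, (if φ i = ψ j then (1 : ℝ) else 0) *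
        (if ∀ x ∈ e φ i ∪ e ψ j, ρ x = 0 then 1 else 0) := by
    intro ρ
    simp only [sq, Finset.sum_mul_sum]
    rw [Finset.sum_comm]
    refine Finset.sum_congr rfl fun φ _ => ?_
    rw [Finset.sum_comm]
    refine Finset.sum_congr rfl fun ψ _ => ?_
    rw [Finset.sum_comm]
    refine Finset.sum_congr rfl fun i _ => ?_
    rw [Finset.sum_comm]
    refine Finset.sum_congr rfl fun j _ => ?_
    rw [Finset.sum_eq_single (φ i)]
    · by_cases h1 : ψ j = φ i
      · simp only [h1, true_and, if_true, one_mul, Finset.forall_mem_union, ite_and,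
          ite_mul, zero_mul]
      · simp [h1, Ne.symm h1]
    · intro v _ hv
      simp [Ne.symm hv]
    · simp
  simp only [e] at hexp
  simp only [hexp]
  have hswap : ∑ ρ : V → Fin (M + 1), ∑ φ ∈ E, ∑ ψ ∈ E, ∑ i, ∑ j,
      (if φ i = ψ j then (1 : ℝ) else 0) *
        (if ∀ x ∈ e φ i ∪ e ψ j, ρ x = 0 then 1 else 0) =
      (M + 1 : ℝ) ^ Fintype.card V * ∑ φ ∈ E, ∑ ψ ∈ E, ∑ i, ∑ j,
        (if φ i = ψ j then (1 : ℝ) else 0) * q ^ (e φ i ∪ e ψ j).card := by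
    rw [Finset.sum_comm, Finset.mul_sum]
    refine Finset.sum_congr rfl fun φ _ => ?_
    rw [Finset.sum_comm, Finset.mul_sum]
    refine Finset.sum_congr rfl fun ψ _ => ?_
    rw [Finset.sum_comm, Finset.mul_sum]
    refine Finset.sum_congr rfl fun i _ => ?_
    rw [Finset.sum_comm, Finset.mul_sum]
    refine Finset.sum_congr rfl fun j _ => ?_
    rw [← Finset.mul_sum, sum_forall_mem_eq_zero]
    ring
  rw [hswap]
  gcongr
  have hterm : ∀ φ ψ : U ↪ V, ∀ i j, (if φ i = ψ j then (1 : ℝ) else 0) *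
      q ^ (e φ i ∪ e ψ j).card ≤ (if φ i = ψ j then (1 : ℝ) else 0) * q ^ (2 * (r - 1)) +
      (if φ i = ψ j then (1 : ℝ) else 0) *
        (if 1 < (univ.map φ ∩ univ.map ψ).card then 1 else 0) := by
    intro φ ψ i j
    by_cases hij : φ i = ψ j
    · simp only [hij, if_true, one_mul]
      by_cases h1 : 1 < (univ.map φ ∩ univ.map ψ).card
      · rw [if_pos h1]
        have := pow_le_one₀ (n := (e φ i ∪ e ψ j).card) hq0 hq1
        have := pow_nonneg hq0 (2 * (r - 1))
        linarith
      · rw [if_neg h1, add_zero]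
        have hdisj : Disjoint (e φ i) (e ψ j) := by
          rw [Finset.disjoint_left]
          intro x hx hx'
          refine h1 (Finset.one_lt_card.2 ⟨φ i, ?_, x, ?_, ?_⟩)
          · simp only [mem_inter, Finset.mem_map, mem_univ, true_and]
            exact ⟨⟨i, rfl⟩, j, hij.symm⟩
          · simp only [e, Finset.mem_map, mem_erase, mem_univ, and_true] at hx hx'
            simp only [mem_inter, Finset.mem_map, mem_univ, true_and]
            exact ⟨hx.imp fun _ h => h.2, hx'.imp fun _ h => h.2⟩
          · rintro rfl
            simp [e] at hx
        rw [Finset.card_union_of_disjoint hdisj]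
        simp [e, two_mul, ← hr]
    · simp [hij]
  calc _ ≤ ∑ φ ∈ E, ∑ ψ ∈ E, ∑ i, ∑ j, ((if φ i = ψ j then (1 : ℝ) else 0) * q ^ (2 * (r - 1)) +
      (if φ i = ψ j then (1 : ℝ) else 0) *
        (if 1 < (univ.map φ ∩ univ.map ψ).card then 1 else 0)) := by
        gcongr with φ _ ψ _ i _ j _
        exact hterm φ ψ i j
    _ = (∑ φ ∈ E, ∑ ψ ∈ E, ∑ i, ∑ j, (if φ i = ψ j then (1 : ℝ) else 0)) * q ^ (2 * (r - 1)) +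
        ∑ φ ∈ E, ∑ ψ ∈ E, (∑ i, ∑ j, (if φ i = ψ j then (1 : ℝ) else 0)) *
        (if 1 < (univ.map φ ∩ univ.map ψ).card then 1 else 0) := by
        simp only [Finset.sum_add_distrib, Finset.sum_mul]
    _ ≤ _ := by
        gcongr ?_ * _ + ?_
        · apply le_of_eq
          have h1 : ∑ φ ∈ E, ∑ ψ ∈ E, ∑ i, ∑ j, (if φ i = ψ j then (1 : ℝ) else 0) =
              ∑ φ ∈ E, ∑ _i : U, (k : ℝ) := by
            refine Finset.sum_congr rfl fun φ _ => ?_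
            rw [Finset.sum_comm]
            refine Finset.sum_congr rfl fun i _ => ?_
            rw [← sum_sum_ite_apply_eq hdeg (φ i)]
            simp only [eq_comm]
          have h2 := card_mul_card_eq hdeg
          rw [h1]
          simp only [sum_const, card_univ, nsmul_eq_mul]
          linear_combination (k : ℝ) * h2
        · have hin : ∀ φ ψ : U ↪ V,
              (∑ i, ∑ j, (if φ i = ψ j then (1 : ℝ) else 0)) ≤ r := by
            intro φ ψ
            calc _ ≤ ∑ i : U, (1 : ℝ) := by
                  gcongr with i _
                  have := sum_ite_apply_eq ψ (φ i)
                  simp only [eq_comm (a := φ i)]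
                  rw [this]
                  split_ifs <;> norm_num
              _ = r := by simp [hr]
          calc _ ≤ ∑ φ ∈ E, ∑ ψ ∈ E, (r : ℝ) *
                ((if 1 < (univ.map φ ∩ univ.map ψ).card ∧
                    (univ.map φ ∩ univ.map ψ).card < r then 1 else 0) +
                  (if r ≤ (univ.map φ ∩ univ.map ψ).card then 1 else 0)) := by
                gcongr with φ _ ψ _
                · exact hin φ ψ
                · by_cases h1 : 1 < (univ.map φ ∩ univ.map ψ).card <;>
                    by_cases h2 : r ≤ (univ.map φ ∩ univ.map ψ).card
                  · simp [h1, h2, not_lt.2 h2]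
                  · simp [h1, h2, not_le.1 h2]
                  · simp [h1]; positivity
                  · simp [h1]; positivity
            _ = (r : ℝ) * ((∑ φ ∈ E, ∑ ψ ∈ E, if 1 < (univ.map φ ∩ univ.map ψ).card ∧
                    (univ.map φ ∩ univ.map ψ).card < r then (1 : ℝ) else 0) +
                  ∑ φ ∈ E, ∑ ψ ∈ E,
                    if r ≤ (univ.map φ ∩ univ.map ψ).card then (1 : ℝ) else 0) := by
                simp only [← Finset.mul_sum, Finset.sum_add_distrib]
            _ ≤ _ := by
                gcongr
                · rw [← Finset.sum_product', Finset.sum_boole]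
                · calc _ ≤ ∑ φ ∈ E, (r : ℝ) ^ r := by
                        gcongr with φ _
                        rw [Finset.sum_boole]
                        exact_mod_cast card_filter_map_eq_le E φ
                    _ = _ := by simp

/-- Pinning: for monotone set functions `g v` with values in `[0, 1]` there is a small set `F` such
that, on average over the edges `φ` and their vertices `φ i`, adding the rest of the edge to `F`
hardly increases `g (φ i)`. -/
theorem exists_pinning_set {E : Finset (U ↪ V)} {k : ℕ}
    (hdeg : ∀ v, (E.filter (fun φ => ∃ i, φ i = v)).card = k)
    {g : V → Finset V → ℝ} (hmono : ∀ v, Monotone (g v)) (h0 : ∀ v F, 0 ≤ g v F)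
    (h1 : ∀ v F, g v F ≤ 1) {c : ℝ} (hc : 0 < c) (M : ℕ) :
    ∃ F : Finset V, c * F.card ≤ Fintype.card V ∧
      (∑ φ ∈ E, ∑ i, (g (φ i) (F ∪ (univ.erase i).map φ) - g (φ i) F)) ^ 2 ≤
        c * Fintype.card V * (M + 1 : ℝ)⁻¹ * ((k : ℝ) ^ 2 * Fintype.card V +
          (M + 1 : ℝ) ^ (2 * (Fintype.card U - 1)) *
          (Fintype.card U * (((E ×ˢ E).filter fun p => 1 < (univ.map p.1 ∩ univ.map p.2).card ∧
              (univ.map p.1 ∩ univ.map p.2).card < Fintype.card U).card +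
            E.card * (Fintype.card U : ℝ) ^ Fintype.card U))) := by
  -- F maximizes total energy minus a cost c per pinned vertex. Comparison with ∅ bounds |F|;
  -- comparison with F ∪ R says that adding R gains at most c|R|.
  obtain ⟨F, -, hF⟩ := Finset.exists_max_image (univ : Finset (Finset V))
    (fun F => ∑ v, g v F - c * F.card) univ_nonempty
  refine ⟨F, ?_, ?_⟩
  · have := hF ∅ (mem_univ _)
    simp only [card_empty, Nat.cast_zero, mul_zero, sub_zero] at this
    have h2 : 0 ≤ ∑ v, g v ∅ := Finset.sum_nonneg fun v _ => h0 v ∅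
    have h3 : ∑ v, g v F ≤ ∑ v : V, (1 : ℝ) := Finset.sum_le_sum fun v _ => h1 v F
    simp only [sum_const, card_univ, nsmul_eq_mul, mul_one] at h3
    linarith
  set r := Fintype.card U with hr
  set J : ℝ := (r : ℝ) * (((E ×ˢ E).filter fun p => 1 < (univ.map p.1 ∩ univ.map p.2).card ∧
              (univ.map p.1 ∩ univ.map p.2).card < r).card + E.card * (r : ℝ) ^ r) with hJ
  set L : ℝ := (M + 1 : ℝ) with hL
  have hLpos : 0 < L := by positivity
  set d := Fintype.card V with hd
  let R : (V → Fin (M + 1)) → Finset V := fun ρ => univ.filter fun v => ρ v = 0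
  let Δ : (V → Fin (M + 1)) → V → ℝ := fun ρ v => g v (F ∪ R ρ) - g v F
  let S : (V → Fin (M + 1)) → V → ℝ := fun ρ v => ∑ φ ∈ E, ∑ i,
        if φ i = v ∧ ∀ x ∈ (univ.erase i).map φ, ρ x = 0 then (1 : ℝ) else 0
  let w : (U ↪ V) → U → ℝ := fun φ i => g (φ i) (F ∪ (univ.erase i).map φ) - g (φ i) F
  have hΔ0 : ∀ ρ v, 0 ≤ Δ ρ v := fun ρ v => sub_nonneg.2 (hmono v subset_union_left)
  have hΔ1 : ∀ ρ v, Δ ρ v ≤ 1 := fun ρ v => by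
    have := h0 v F
    have := h1 v (F ∪ R ρ)
    simp only [Δ]; linarith
  -- Increments lie in [0, 1], so their squares are dominated by the increments themselves, whose
  -- total is at most c|R| by maximality. Averaging over R brings in the density 1/L.
  have hΔsum : ∑ ρ, ∑ v, Δ ρ v ^ 2 ≤ c * d * L ^ d * L⁻¹ := by
    calc ∑ ρ, ∑ v, Δ ρ v ^ 2 ≤ ∑ ρ, ∑ v, Δ ρ v := by
          gcongr with ρ _ v _
          have := hΔ0 ρ v
          have := hΔ1 ρ v
          nlinarith
      _ ≤ ∑ ρ, c * (R ρ).card := by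
          gcongr with ρ _
          have h2 := hF (F ∪ R ρ) (mem_univ _)
          have h3 : ((F ∪ R ρ).card : ℝ) ≤ F.card + (R ρ).card := by
            exact_mod_cast Finset.card_union_le _ _
          have h4 : ∑ v, Δ ρ v = ∑ v, g v (F ∪ R ρ) - ∑ v, g v F := by
            simp [Δ, Finset.sum_sub_distrib]
          rw [h4]
          nlinarith
      _ = c * ∑ v : V, ∑ ρ : V → Fin (M + 1), if ∀ x ∈ ({v} : Finset V), ρ x = 0
            then (1 : ℝ) else 0 := by
          rw [← Finset.mul_sum, Finset.sum_comm]
          simp [R, Finset.sum_boole]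
      _ = _ := by
          simp only [sum_forall_mem_eq_zero]
          simp [← hd, ← hL]; ring
  -- The rest of an edge lies in R with probability L^{-(r-1)}, and then by monotonicity the gain
  -- from R is at least the gain from that edge.
  have hw : (∑ φ ∈ E, ∑ i, w φ i) * (L ^ d * L⁻¹ ^ (r - 1)) ≤ ∑ ρ, ∑ v, Δ ρ v * S ρ v := by
    calc (∑ φ ∈ E, ∑ i, w φ i) * (L ^ d * L⁻¹ ^ (r - 1))
        = ∑ φ ∈ E, ∑ i, ∑ ρ : V → Fin (M + 1),
            (if ∀ x ∈ (univ.erase i).map φ, ρ x = 0 then (1 : ℝ) else 0) * w φ i := by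
          rw [Finset.sum_mul]
          refine Finset.sum_congr rfl fun φ _ => ?_
          rw [Finset.sum_mul]
          refine Finset.sum_congr rfl fun i _ => ?_
          rw [← Finset.sum_mul, sum_forall_mem_eq_zero]
          simp [← hr, ← hL, ← hd]
          ring
      _ = ∑ ρ : V → Fin (M + 1), ∑ φ ∈ E, ∑ i,
            (if ∀ x ∈ (univ.erase i).map φ, ρ x = 0 then (1 : ℝ) else 0) * w φ i := by
          rw [Finset.sum_comm (s := univ) (t := E)]
          refine Finset.sum_congr rfl fun φ _ => ?_
          rw [Finset.sum_comm]
      _ ≤ ∑ ρ : V → Fin (M + 1), ∑ φ ∈ E, ∑ i,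
            (if ∀ x ∈ (univ.erase i).map φ, ρ x = 0 then (1 : ℝ) else 0) * Δ ρ (φ i) := by
          refine Finset.sum_le_sum fun ρ _ => Finset.sum_le_sum fun φ _ =>
            Finset.sum_le_sum fun i _ => ?_
          by_cases h : ∀ x ∈ (univ.erase i).map φ, ρ x = 0
          · rw [if_pos h, one_mul, one_mul]
            refine sub_le_sub_right (hmono _ (union_subset_union_right ?_)) _
            intro x hx
            simpa [R] using h x hx
          · rw [if_neg h, zero_mul, zero_mul]
      _ = _ := by
          refine Finset.sum_congr rfl fun ρ _ => ?_
          simp only [S, Finset.mul_sum]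
          rw [Finset.sum_comm (s := univ) (t := E)]
          refine Finset.sum_congr rfl fun φ _ => ?_
          rw [Finset.sum_comm (s := univ) (t := univ)]
          refine Finset.sum_congr rfl fun i _ => ?_
          rw [Finset.sum_eq_single (φ i)]
          · simp
          · intro v _ hv
            simp [Ne.symm hv]
          · simp
  have hcs : (∑ ρ, ∑ v, Δ ρ v * S ρ v) ^ 2 ≤
      (∑ ρ, ∑ v, Δ ρ v ^ 2) * ∑ ρ, ∑ v, S ρ v ^ 2 := by
    simp only [← Finset.sum_product']
    exact Finset.sum_mul_sq_le_sq_mul_sq _ _ _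
  have hS : ∑ ρ, ∑ v, S ρ v ^ 2 ≤ L ^ d * ((k : ℝ) ^ 2 * d * L⁻¹ ^ (2 * (r - 1)) + J) :=
    sum_sq_incidence_le hdeg M
  have hw0 : 0 ≤ ∑ φ ∈ E, ∑ i, w φ i := Finset.sum_nonneg fun φ _ =>
    Finset.sum_nonneg fun i _ => sub_nonneg.2 (hmono _ subset_union_left)
  have hJ0 : 0 ≤ J := by positivity
  have hmain : ((∑ φ ∈ E, ∑ i, w φ i) * (L ^ d * L⁻¹ ^ (r - 1))) ^ 2 ≤
      (c * d * L ^ d * L⁻¹) * (L ^ d * ((k : ℝ) ^ 2 * d * L⁻¹ ^ (2 * (r - 1)) + J)) := by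
    calc _ ≤ (∑ ρ, ∑ v, Δ ρ v * S ρ v) ^ 2 := by
          gcongr
      _ ≤ _ := hcs
      _ ≤ _ := by gcongr
  change (∑ φ ∈ E, ∑ i, w φ i) ^ 2 ≤ c * d * L⁻¹ * ((k : ℝ) ^ 2 * d + L ^ (2 * (r - 1)) * J)
  have hpos : 0 < (L ^ d * L⁻¹ ^ (r - 1)) ^ 2 := by positivity
  refine le_of_mul_le_mul_right ?_ hpos
  rw [← mul_pow]
  refine hmain.trans (le_of_eq ?_)
  have hLL : L ^ (2 * (r - 1)) * L⁻¹ ^ (2 * (r - 1)) = 1 := by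
    rw [← mul_pow, mul_inv_cancel₀ hLpos.ne', one_pow]
  have h5 : (L ^ d * L⁻¹ ^ (r - 1)) ^ 2 = (L ^ d) ^ 2 * L⁻¹ ^ (2 * (r - 1)) := by
    rw [mul_pow, ← pow_mul L⁻¹, mul_comm (r - 1) 2]
  rw [h5]
  linear_combination (-(c * d * L⁻¹ * (L ^ d) ^ 2 * J)) * hLL

end Pinning

/-! ### Conditional colour distributions, energies and near independence. -/

section CondMean

open Finset

variable {V K : Type*} [Fintype V] [Fintype K] [DecidableEq V] [DecidableEq K]

/-- Conditional expectation of `f` given the coordinates in `G`, for the weights `μ`. -/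
noncomputable def condMean (μ : (V → K) → ℝ) (G : Finset V) (f : (V → K) → ℝ) (x : V → K) : ℝ :=
  (∑ y with ∀ v ∈ G, y v = x v, μ y * f y) / ∑ y with ∀ v ∈ G, y v = x v, μ y

/-- Indicator of the event that the vertex `v` has colour `a`. -/
def colourInd (v : V) (a : K) (x : V → K) : ℝ := if x v = a then 1 else 0

variable {μ : (V → K) → ℝ}

theorem condMean_congr {G : Finset V} (f : (V → K) → ℝ) {x y : V → K}
    (h : ∀ v ∈ G, x v = y v) : condMean μ G f x = condMean μ G f y := by
  have : (univ.filter fun z : V → K => ∀ v ∈ G, z v = x v) =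
      univ.filter fun z : V → K => ∀ v ∈ G, z v = y v := by
    ext z
    simp only [mem_filter, mem_univ, true_and]
    exact forall₂_congr fun v hv => by rw [h v hv]
  simp only [condMean, this]

/-- The defining property of conditional expectation, by exchanging the roles of x and y in a double
sum over pairs agreeing on G. On a fibre of total weight zero the quotient is 0, which is harmless
since μ vanishes there. -/
theorem sum_mul_condMean_mul (hμ : ∀ x, 0 ≤ μ x) {G : Finset V} (f : (V → K) → ℝ)
    {h : (V → K) → ℝ} (hh : ∀ x y, (∀ v ∈ G, x v = y v) → h x = h y) :
    ∑ x, μ x * condMean μ G f x * h x = ∑ x, μ x * f x * h x := by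
  let Z : (V → K) → ℝ := fun x => ∑ y with ∀ v ∈ G, y v = x v, μ y
  have hZ : ∀ x y, (∀ v ∈ G, y v = x v) → Z x = Z y := by
    intro x y hxy
    have : (univ.filter fun z : V → K => ∀ v ∈ G, z v = x v) =
        univ.filter fun z : V → K => ∀ v ∈ G, z v = y v := by
      ext z
      simp only [mem_filter, mem_univ, true_and]
      exact forall₂_congr fun v hv => by rw [hxy v hv]
    simp only [Z, this]
  calc ∑ x, μ x * condMean μ G f x * h x
      = ∑ x, ∑ y, if ∀ v ∈ G, y v = x v then μ y * f y * (μ x * h x / Z x) else 0 := by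
        refine Finset.sum_congr rfl fun x _ => ?_
        rw [← Finset.sum_filter, ← Finset.sum_mul]
        simp only [condMean, Z]
        ring
    _ = ∑ y, ∑ x, if ∀ v ∈ G, x v = y v then μ y * f y * (μ x * h y / Z y) else 0 := by
        rw [Finset.sum_comm]
        refine Finset.sum_congr rfl fun y _ => Finset.sum_congr rfl fun x _ => ?_
        by_cases hxy : ∀ v ∈ G, y v = x v
        · have hyx : ∀ v ∈ G, x v = y v := fun v hv => (hxy v hv).symm
          rw [if_pos hxy, if_pos hyx, hZ x y hxy, hh x y hyx]
        · have hyx : ¬ ∀ v ∈ G, x v = y v := fun h => hxy fun v hv => (h v hv).symm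
          rw [if_neg hxy, if_neg hyx]
    _ = ∑ y, μ y * f y * h y := by
        refine Finset.sum_congr rfl fun y _ => ?_
        rw [← Finset.sum_filter, ← Finset.mul_sum, ← Finset.sum_div, ← Finset.sum_mul]
        change μ y * f y * (Z y * h y / Z y) = _
        by_cases h0 : Z y = 0
        · have : μ y = 0 := by
            refine (Finset.sum_eq_zero_iff_of_nonneg fun z _ => hμ z).1 h0 y ?_
            simp
          simp [this]
        · field_simp

theorem condMean_nonneg (hμ : ∀ x, 0 ≤ μ x) (G : Finset V) {f : (V → K) → ℝ}
    (hf : ∀ x, 0 ≤ f x) (x : V → K) : 0 ≤ condMean μ G f x :=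
  div_nonneg (Finset.sum_nonneg fun y _ => mul_nonneg (hμ y) (hf y))
    (Finset.sum_nonneg fun y _ => hμ y)

theorem sum_condMean_colourInd_le_one (G : Finset V) (v : V) (x : V → K) :
    ∑ a, condMean μ G (colourInd v a) x ≤ 1 := by
  simp only [condMean, ← Finset.sum_div]
  rw [Finset.sum_comm]
  simp only [← Finset.mul_sum, colourInd, Finset.sum_ite_eq, mem_univ, if_true, mul_one]
  exact div_self_le_one _

theorem sum_condMean_colourInd (hμ : ∀ x, 0 ≤ μ x) (G : Finset V) (v : V) {x : V → K}
    (hx : 0 < μ x) : ∑ a, condMean μ G (colourInd v a) x = 1 := by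
  simp only [condMean, ← Finset.sum_div]
  rw [Finset.sum_comm]
  simp only [← Finset.mul_sum, colourInd, Finset.sum_ite_eq, mem_univ, if_true, mul_one]
  refine div_self (ne_of_gt ?_)
  exact Finset.sum_pos' (fun y _ => hμ y) ⟨x, by simp, hx⟩

theorem colourInd_nonneg (v : V) (a : K) (x : V → K) : 0 ≤ colourInd v a x := by
  unfold colourInd; split_ifs <;> norm_num

theorem colourInd_le_one (v : V) (a : K) (x : V → K) : colourInd v a x ≤ 1 := by
  unfold colourInd; split_ifs <;> norm_num

theorem condMean_colourInd_nonneg (hμ : ∀ x, 0 ≤ μ x) (G : Finset V) (v : V) (a : K)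
    (x : V → K) : 0 ≤ condMean μ G (colourInd v a) x :=
  condMean_nonneg hμ G (colourInd_nonneg v a) x

theorem condMean_colourInd_le_one (hμ : ∀ x, 0 ≤ μ x) (G : Finset V) (v : V) (a : K)
    (x : V → K) : condMean μ G (colourInd v a) x ≤ 1 :=
  (Finset.single_le_sum (f := fun a => condMean μ G (colourInd v a) x)
    (fun b _ => condMean_colourInd_nonneg hμ G v b x) (mem_univ a)).trans
    (sum_condMean_colourInd_le_one G v x)

/-- Pythagoras for nested conditional expectations: the increment is orthogonal to the coarser one.
This makes the energy monotone and makes a small energy increment an L² estimate. -/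
theorem sum_mul_sub_condMean_sq (hμ : ∀ x, 0 ≤ μ x) {G G' : Finset V} (hG : G ⊆ G')
    (f : (V → K) → ℝ) :
    ∑ x, μ x * (condMean μ G' f x - condMean μ G f x) ^ 2 =
      ∑ x, μ x * condMean μ G' f x ^ 2 - ∑ x, μ x * condMean μ G f x ^ 2 := by
  have h1 := sum_mul_condMean_mul hμ (G := G) f (h := condMean μ G f)
    (fun x y h => condMean_congr f h)
  have h2 := sum_mul_condMean_mul hμ (G := G') f (h := condMean μ G f)
    (fun x y h => condMean_congr f fun v hv => h v (hG hv))
  have h3 : ∑ x, μ x * (condMean μ G' f x - condMean μ G f x) ^ 2 =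
      ∑ x, μ x * condMean μ G' f x ^ 2 - 2 * ∑ x, μ x * condMean μ G' f x * condMean μ G f x +
        ∑ x, μ x * condMean μ G f x * condMean μ G f x := by
    rw [Finset.mul_sum, ← Finset.sum_sub_distrib, ← Finset.sum_add_distrib]
    exact Finset.sum_congr rfl fun x _ => by ring
  have h4 : ∑ x, μ x * condMean μ G f x ^ 2 = ∑ x, μ x * condMean μ G f x * condMean μ G f x :=
    Finset.sum_congr rfl fun x _ => by ring
  rw [h3, h4]
  linarith

/-- The mean square of the conditional distribution of the colour of `v` given the colours of the
vertices in `G`. -/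
noncomputable def colourEnergy (μ : (V → K) → ℝ) (v : V) (G : Finset V) : ℝ :=
  ∑ a, ∑ x, μ x * condMean μ G (colourInd v a) x ^ 2

theorem colourEnergy_nonneg (hμ : ∀ x, 0 ≤ μ x) (v : V) (G : Finset V) :
    0 ≤ colourEnergy μ v G :=
  Finset.sum_nonneg fun _ _ => Finset.sum_nonneg fun x _ => mul_nonneg (hμ x) (sq_nonneg _)

theorem colourEnergy_le_one (hμ : ∀ x, 0 ≤ μ x) (h1 : ∑ x, μ x = 1) (v : V) (G : Finset V) :
    colourEnergy μ v G ≤ 1 := by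
  rw [colourEnergy, Finset.sum_comm, ← h1]
  refine Finset.sum_le_sum fun x _ => ?_
  rw [← Finset.mul_sum]
  refine mul_le_of_le_one_right (hμ x) ?_
  refine le_trans (Finset.sum_le_sum fun a _ => ?_) (sum_condMean_colourInd_le_one (μ := μ) G v x)
  have := condMean_colourInd_nonneg hμ G v a x
  have := condMean_colourInd_le_one hμ G v a x
  nlinarith

theorem sum_mul_sub_condMean_sq_le (hμ : ∀ x, 0 ≤ μ x) {G G' : Finset V} (hG : G ⊆ G')
    (v : V) (a : K) :
    ∑ x, μ x * (condMean μ G' (colourInd v a) x - condMean μ G (colourInd v a) x) ^ 2 ≤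
      colourEnergy μ v G' - colourEnergy μ v G := by
  rw [colourEnergy, colourEnergy, ← Finset.sum_sub_distrib]
  simp only [← sum_mul_sub_condMean_sq hμ hG]
  exact Finset.single_le_sum (f := fun a => ∑ x, μ x * (condMean μ G' (colourInd v a) x -
    condMean μ G (colourInd v a) x) ^ 2) (fun b _ => Finset.sum_nonneg fun x _ =>
      mul_nonneg (hμ x) (sq_nonneg _)) (mem_univ a)

theorem colourEnergy_mono (hμ : ∀ x, 0 ≤ μ x) (v : V) : Monotone (colourEnergy μ v) := by
  intro G G' hG
  rw [← sub_nonneg, colourEnergy, colourEnergy, ← Finset.sum_sub_distrib]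
  simp only [← sum_mul_sub_condMean_sq hμ hG]
  exact Finset.sum_nonneg fun b _ => Finset.sum_nonneg fun x _ =>
      mul_nonneg (hμ x) (sq_nonneg _)

theorem sum_mul_mul_le_sqrt (hμ : ∀ x, 0 ≤ μ x) (h1 : ∑ x, μ x = 1) (d H : (V → K) → ℝ)
    (hH0 : ∀ x, 0 ≤ H x) (hH1 : ∀ x, H x ≤ 1) :
    ∑ x, μ x * d x * H x ≤ √(∑ x, μ x * d x ^ 2) := by
  refine Real.le_sqrt_of_sq_le ?_
  have h2 : ∑ x, μ x * H x ^ 2 ≤ 1 := by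
    rw [← h1]
    refine Finset.sum_le_sum fun x _ => mul_le_of_le_one_right (hμ x) ?_
    exact pow_le_one₀ (hH0 x) (hH1 x)
  have h3 : 0 ≤ ∑ x, μ x * d x ^ 2 :=
    Finset.sum_nonneg fun x _ => mul_nonneg (hμ x) (sq_nonneg _)
  calc (∑ x, μ x * d x * H x) ^ 2 ≤ (∑ x, μ x * d x ^ 2) * ∑ x, μ x * H x ^ 2 := by
        refine Finset.sum_sq_le_sum_mul_sum_of_sq_le_mul _
          (fun x _ => mul_nonneg (hμ x) (sq_nonneg _))
          (fun x _ => mul_nonneg (hμ x) (sq_nonneg _)) (fun x _ => le_of_eq (by ring))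
    _ ≤ _ := mul_le_of_le_one_right h3 h2

/-- Since H depends only on G, the indicator may be replaced by its conditional mean given G.
Passing from G down to F costs an L² distance, bounded by the square root of the energy increment.
-/
theorem sum_mul_condMean_mul_le (hμ : ∀ x, 0 ≤ μ x) (h1 : ∑ x, μ x = 1) {F G : Finset V}
    (hFG : F ⊆ G) (v : V) (a : K) {H : (V → K) → ℝ}
    (hH : ∀ x z, (∀ v ∈ G, x v = z v) → H x = H z) (hH0 : ∀ x, 0 ≤ H x) (hH1 : ∀ x, H x ≤ 1) :
    ∑ x, μ x * condMean μ F (colourInd v a) x * H x ≤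
      ∑ x, μ x * colourInd v a x * H x + √(colourEnergy μ v G - colourEnergy μ v F) := by
  have hcond := sum_mul_condMean_mul hμ (G := G) (colourInd v a) hH
  have hcs := sum_mul_mul_le_sqrt hμ h1 (fun x => condMean μ F (colourInd v a) x -
    condMean μ G (colourInd v a) x) H hH0 hH1
  have hsq : √(∑ x, μ x * (condMean μ F (colourInd v a) x -
      condMean μ G (colourInd v a) x) ^ 2) ≤ √(colourEnergy μ v G - colourEnergy μ v F) := by
    refine Real.sqrt_le_sqrt ?_
    refine le_trans (le_of_eq ?_) (sum_mul_sub_condMean_sq_le hμ hFG v a)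
    exact Finset.sum_congr rfl fun x _ => by ring
  have hdiff : ∑ x, μ x * (condMean μ F (colourInd v a) x -
      condMean μ G (colourInd v a) x) * H x =
      ∑ x, μ x * condMean μ F (colourInd v a) x * H x -
        ∑ x, μ x * condMean μ G (colourInd v a) x * H x := by
    rw [← Finset.sum_sub_distrib]
    exact Finset.sum_congr rfl fun x _ => by ring
  linarith

variable {U : Type*} [Fintype U] [DecidableEq U]

/-- Telescoping: replace the factors of a product one at a time. -/
theorem sum_mul_prod_le_of_replace {Ω : Type*} [Fintype Ω] (μ : Ω → ℝ) (p y : U → Ω → ℝ)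
    (w : U → ℝ) (hstep : ∀ j s, j ∉ s →
      ∑ x, μ x * p j x * ((∏ i ∈ s, p i x) * ∏ i ∈ (insert j s)ᶜ, y i x) ≤
        ∑ x, μ x * y j x * ((∏ i ∈ s, p i x) * ∏ i ∈ (insert j s)ᶜ, y i x) + w j) :
    ∑ x, μ x * ∏ i, p i x ≤ ∑ x, μ x * ∏ i, y i x + ∑ i, w i := by
  have key : ∀ s : Finset U, ∑ x, μ x * ((∏ i ∈ s, p i x) * ∏ i ∈ sᶜ, y i x) ≤
      ∑ x, μ x * ∏ i, y i x + ∑ i ∈ s, w i := by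
    intro s
    induction s using Finset.induction with
    | empty => simp
    | insert j s hj ih =>
      have hL : ∑ x, μ x * ((∏ i ∈ insert j s, p i x) * ∏ i ∈ (insert j s)ᶜ, y i x) =
          ∑ x, μ x * p j x * ((∏ i ∈ s, p i x) * ∏ i ∈ (insert j s)ᶜ, y i x) := by
        refine Finset.sum_congr rfl fun x _ => ?_
        rw [Finset.prod_insert hj]
        ring
      have hR : ∑ x, μ x * ((∏ i ∈ s, p i x) * ∏ i ∈ sᶜ, y i x) =
          ∑ x, μ x * y j x * ((∏ i ∈ s, p i x) * ∏ i ∈ (insert j s)ᶜ, y i x) := by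
        refine Finset.sum_congr rfl fun x _ => ?_
        have : sᶜ = insert j (insert j s)ᶜ := by
          ext i
          simp only [mem_compl, mem_insert]
          by_cases hij : i = j
          · simp [hij, hj]
          · simp [hij]
        rw [this, Finset.prod_insert (by simp)]
        ring
      have h := hstep j s hj
      rw [hL, Finset.sum_insert hj]
      rw [hR] at ih
      linarith
  simpa using key univ

/-- If conditioning on the rest of an edge hardly increases the energies of its vertices, then the
colours of the vertices of the edge are nearly independent given the colours in `F`. -/
theorem sum_mul_prod_condMean_le (hμ : ∀ x, 0 ≤ μ x) (h1 : ∑ x, μ x = 1) (F : Finset V)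
    (φ : U ↪ V) (a : U → K) :
    ∑ x, μ x * ∏ i, condMean μ F (colourInd (φ i) (a i)) x ≤
      ∑ x, μ x * ∏ i, colourInd (φ i) (a i) x +
      ∑ i, √(colourEnergy μ (φ i) (F ∪ (univ.erase i).map φ) - colourEnergy μ (φ i) F) := by
  refine sum_mul_prod_le_of_replace μ (fun i => condMean μ F (colourInd (φ i) (a i)))
    (fun i => colourInd (φ i) (a i)) _ fun j s hj => ?_
  have hp0 : ∀ i x, 0 ≤ condMean μ F (colourInd (φ i) (a i)) x :=
    fun i x => condMean_colourInd_nonneg hμ F _ _ x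
  have hp1 : ∀ i x, condMean μ F (colourInd (φ i) (a i)) x ≤ 1 :=
    fun i x => condMean_colourInd_le_one hμ F _ _ x
  have hy0 : ∀ i x, 0 ≤ colourInd (φ i) (a i) x := fun i x => colourInd_nonneg _ _ x
  have hy1 : ∀ i x, colourInd (φ i) (a i) x ≤ 1 := fun i x => colourInd_le_one _ _ x
  -- At step j the other factors are conditional means given F or indicators at vertices φ i with i
  -- ≠ j, so together they depend only on F and the rest of the edge.
  refine sum_mul_condMean_mul_le hμ h1 subset_union_left (φ j) (a j) ?_ ?_ ?_
  · intro x z hxz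
    have e1 : ∏ i ∈ s, condMean μ F (colourInd (φ i) (a i)) x =
        ∏ i ∈ s, condMean μ F (colourInd (φ i) (a i)) z :=
      Finset.prod_congr rfl fun i _ => condMean_congr _ fun v hv => hxz v (mem_union_left _ hv)
    have e2 : ∏ i ∈ (insert j s)ᶜ, colourInd (φ i) (a i) x =
        ∏ i ∈ (insert j s)ᶜ, colourInd (φ i) (a i) z := by
      refine Finset.prod_congr rfl fun i hi => ?_
      have hij : i ≠ j := by
        rintro rfl
        simp at hi
      have : x (φ i) = z (φ i) := hxz _ (mem_union_right _ (by simp [hij]))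
      simp only [colourInd, this]
    simp only [e1, e2]
  · exact fun x => mul_nonneg
      (Finset.prod_nonneg fun i _ => hp0 i x) (Finset.prod_nonneg fun i _ => hy0 i x)
  · exact fun x => mul_le_one₀
      (Finset.prod_le_one (fun i _ => hp0 i x) fun i _ => hp1 i x)
      (Finset.prod_nonneg fun i _ => hy0 i x)
      (Finset.prod_le_one (fun i _ => hy0 i x) fun i _ => hy1 i x)

theorem prod_colourInd (φ : U ↪ V) (a : U → K) (x : V → K) :
    ∏ i, colourInd (φ i) (a i) x = if x ∘ φ = a then 1 else 0 := by
  simp only [colourInd, Finset.prod_ite_zero, Finset.prod_const_one, mem_univ, true_imp_iff]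
  simp [funext_iff]

theorem sum_mul_sum_prod_condMean_le (hμ : ∀ x, 0 ≤ μ x) (h1 : ∑ x, μ x = 1) (F : Finset V)
    (φ : U ↪ V) (Q : Finset (U → K)) :
    ∑ x, μ x * ∑ a ∈ Q, ∏ i, condMean μ F (colourInd (φ i) (a i)) x ≤
      (∑ x, μ x * if x ∘ φ ∈ Q then 1 else 0) + (Fintype.card K : ℝ) ^ Fintype.card U *
      ∑ i, √(colourEnergy μ (φ i) (F ∪ (univ.erase i).map φ) - colourEnergy μ (φ i) F) := by
  set w := ∑ i, √(colourEnergy μ (φ i) (F ∪ (univ.erase i).map φ) - colourEnergy μ (φ i) F)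
  have hw : 0 ≤ w := Finset.sum_nonneg fun i _ => Real.sqrt_nonneg _
  calc _ = ∑ a ∈ Q, ∑ x, μ x * ∏ i, condMean μ F (colourInd (φ i) (a i)) x := by
        simp only [Finset.mul_sum]
        rw [Finset.sum_comm]
    _ ≤ ∑ a ∈ Q, (∑ x, μ x * ∏ i, colourInd (φ i) (a i) x + w) :=
        Finset.sum_le_sum fun a _ => sum_mul_prod_condMean_le hμ h1 F φ a
    _ = (∑ x, μ x * ∑ a ∈ Q, ∏ i, colourInd (φ i) (a i) x) + Q.card * w := by
        rw [Finset.sum_add_distrib, Finset.sum_comm]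
        simp only [Finset.mul_sum, sum_const, nsmul_eq_mul]
    _ ≤ _ := by
        gcongr
        · rename_i x _
          apply hμ
        · rename_i x _
          simp only [prod_colourInd, Finset.sum_ite_eq, le_refl]
        · have : Q.card ≤ Fintype.card (U → K) := Finset.card_le_univ Q
          rw [Fintype.card_fun] at this
          exact_mod_cast this

end CondMean

/-! ### Gibbs' inequality for conditional product densities. -/

section Gibbs

open Finset

variable {V K : Type*} [Fintype V] [Fintype K] [DecidableEq V]

/-- Resampling one coordinate preserves a product law: exchanging x j with the fresh colour is a
weight-preserving involution. -/
theorem sum_prod_mul_update {p : K → ℝ} (hp1 : ∑ a, p a = 1) (j : V) (f : (V → K) → ℝ) :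
    ∑ x : V → K, (∏ v, p (x v)) * ∑ a, p a * f (Function.update x j a) =
      ∑ x : V → K, (∏ v, p (x v)) * f x := by
  have hinv : Function.Involutive
      (fun z : (V → K) × K => (Function.update z.1 j z.2, z.1 j)) := by
    rintro ⟨x, a⟩
    simp
  have hswap : ∀ x : V → K, ∀ a, (∏ v, p (x v)) * p a =
      (∏ v, p (Function.update x j a v)) * p (x j) := by
    intro x a
    rw [← Finset.mul_prod_erase univ (fun v => p (x v)) (mem_univ j),
      ← Finset.mul_prod_erase univ (fun v => p (Function.update x j a v)) (mem_univ j)]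
    have : ∏ v ∈ univ.erase j, p (Function.update x j a v) = ∏ v ∈ univ.erase j, p (x v) :=
      Finset.prod_congr rfl fun v hv => by rw [Function.update_of_ne (ne_of_mem_erase hv)]
    rw [this, Function.update_self]
    ring
  calc _ = ∑ z : (V → K) × K, ((∏ v, p (z.1 v)) * p z.2) * f (Function.update z.1 j z.2) := by
        rw [Fintype.sum_prod_type]
        refine Finset.sum_congr rfl fun x _ => ?_
        rw [Finset.mul_sum]
        exact Finset.sum_congr rfl fun a _ => by ring
    _ = ∑ z : (V → K) × K, ((∏ v, p (z.1 v)) * p z.2) * f z.1 := by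
        rw [← Equiv.sum_comp hinv.toPerm
          (fun z : (V → K) × K => ((∏ v, p (z.1 v)) * p z.2) * f z.1)]
        refine Finset.sum_congr rfl fun z _ => ?_
        simp only [Function.Involutive.coe_toPerm]
        rw [hswap z.1 z.2]
    _ = _ := by
        rw [Fintype.sum_prod_type]
        refine Finset.sum_congr rfl fun x _ => ?_
        dsimp only
        rw [← Finset.sum_mul, ← Finset.mul_sum, hp1, mul_one]

/-- The factors depend on the other coordinates only through F, so the coordinates of s can be
integrated out one at a time, each contributing a factor at most one. -/
theorem sum_prod_mul_prod_density_le_one {p : K → ℝ} (hp : ∀ a, 0 ≤ p a) (hp1 : ∑ a, p a = 1)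
    {F : Finset V} {ℓ : V → (V → K) → K → ℝ} (hℓ0 : ∀ v x a, 0 ≤ ℓ v x a)
    (hdep : ∀ v x y, (∀ u ∈ F, x u = y u) → ℓ v x = ℓ v y)
    (hℓ : ∀ v x, ∑ a, p a * ℓ v x a ≤ 1) (s : Finset V) (hs : Disjoint s F) :
    ∑ x : V → K, (∏ v, p (x v)) * ∏ v ∈ s, ℓ v x (x v) ≤ 1 := by
  induction s using Finset.induction with
  | empty =>
    simp only [Finset.prod_empty, mul_one]
    rw [← Fintype.prod_sum (fun (_ : V) a => p a)]
    simp [hp1]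
  | insert j s hj ih =>
    rw [Finset.disjoint_insert_left] at hs
    refine le_trans ?_ (ih hs.2)
    rw [← sum_prod_mul_update hp1 j (fun x => ∏ v ∈ insert j s, ℓ v x (x v))]
    refine Finset.sum_le_sum fun x _ => ?_
    refine mul_le_mul_of_nonneg_left ?_ (Finset.prod_nonneg fun v _ => hp _)
    have hupd : ∀ a, ∀ u ∈ F, Function.update x j a u = x u := fun a u hu => by
      rw [Function.update_of_ne]
      rintro rfl
      exact hs.1 hu
    have h1 : ∀ a, ∏ v ∈ insert j s, ℓ v (Function.update x j a) (Function.update x j a v) =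
        ℓ j x a * ∏ v ∈ s, ℓ v x (x v) := by
      intro a
      rw [Finset.prod_insert hj, hdep j _ x (hupd a), Function.update_self]
      congr 1
      refine Finset.prod_congr rfl fun v hv => ?_
      rw [hdep v _ x (hupd a), Function.update_of_ne]
      rintro rfl
      exact hj hv
    simp only [h1, ← mul_assoc]
    rw [← Finset.sum_mul]
    exact mul_le_of_le_one_left (Finset.prod_nonneg fun v _ => hℓ0 _ _ _) (hℓ j x)

/-- Gibbs' inequality for a product density whose factors depend on the coordinates in `F`. -/
theorem sum_mul_log_density_le {p : K → ℝ} (hp : ∀ a, 0 ≤ p a) (hp1 : ∑ a, p a = 1)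
    {F : Finset V} {ℓ : V → (V → K) → K → ℝ} (hℓ0 : ∀ v x a, 0 < ℓ v x a)
    (hdep : ∀ v x y, (∀ u ∈ F, x u = y u) → ℓ v x = ℓ v y)
    (hℓ : ∀ v x, ∑ a, p a * ℓ v x a ≤ 1) {μ : (V → K) → ℝ} (hμ : ∀ x, 0 ≤ μ x)
    (hμ1 : ∑ x, μ x = 1) {W : ℝ} (hW : 0 < W) (hWμ : ∀ x, W * μ x ≤ ∏ v, p (x v)) :
    ∑ x, μ x * ∑ v ∈ Fᶜ, Real.log (ℓ v x (x v)) ≤ -Real.log W := by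
  have hsum := sum_prod_mul_prod_density_le_one hp hp1 (fun v x a => (hℓ0 v x a).le) hdep hℓ Fᶜ
    disjoint_compl_left
  have hpt : ∀ x, μ x * ∑ v ∈ Fᶜ, Real.log (ℓ v x (x v)) ≤
      μ x * (-Real.log W - 1) + (∏ v, p (x v)) * ∏ v ∈ Fᶜ, ℓ v x (x v) := by
    intro x
    have ht : 0 < ∏ v ∈ Fᶜ, ℓ v x (x v) := Finset.prod_pos fun v _ => hℓ0 _ _ _
    rw [← Real.log_prod (fun v _ => (hℓ0 v x (x v)).ne')]
    set t := ∏ v ∈ Fᶜ, ℓ v x (x v)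
    rcases (hμ x).eq_or_lt with h0 | h0
    · rw [← h0]
      have : 0 ≤ ∏ v, p (x v) := Finset.prod_nonneg fun v _ => hp _
      simp only [zero_mul, zero_add]
      positivity
    · have h1 : Real.log (W * t) ≤ W * t - 1 := Real.log_le_sub_one_of_pos (by positivity)
      have hlog : Real.log t ≤ -Real.log W - 1 + (∏ v, p (x v)) * t / μ x := by
        have h2 : W * t ≤ (∏ v, p (x v)) * t / μ x := by
          rw [le_div_iff₀ h0]
          nlinarith [hWμ x]
        rw [Real.log_mul hW.ne' ht.ne'] at h1
        linarith
      calc μ x * Real.log t ≤ μ x * (-Real.log W - 1 + (∏ v, p (x v)) * t / μ x) := by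
            gcongr
        _ = _ := by field_simp
  calc _ ≤ ∑ x, (μ x * (-Real.log W - 1) + (∏ v, p (x v)) * ∏ v ∈ Fᶜ, ℓ v x (x v)) :=
        Finset.sum_le_sum fun x _ => hpt x
    _ ≤ _ := by
        rw [Finset.sum_add_distrib, ← Finset.sum_mul, hμ1]
        linarith

end Gibbs

/-! ### Containers and their entropy. -/

section Containers

open Finset

variable {V K U : Type*} [Fintype V] [Fintype K] [Fintype U] [DecidableEq V] [DecidableEq K]
  [DecidableEq U]

open Classical in
/-- The colours available at `v` given the colours of the pinned set `F`: those whose conditional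
density with respect to the weights `p` is at least `θ`. Pinned vertices get all colours. -/
noncomputable def container (μ : (V → K) → ℝ) (p : K → ℝ) (θ : ℝ) (F : Finset V) (v : V)
    (x : V → K) : Finset K :=
  if v ∈ F then univ else univ.filter fun a => θ * p a ≤ condMean μ F (colourInd v a) x

variable {μ : (V → K) → ℝ} {p : K → ℝ} {θ : ℝ} {F : Finset V}

theorem container_of_mem {v : V} (hv : v ∈ F) (x : V → K) : container μ p θ F v x = univ := by
  simp [container, hv]

theorem mem_container {v : V} (hv : v ∉ F) (x : V → K) (a : K) :
    a ∈ container μ p θ F v x ↔ θ * p a ≤ condMean μ F (colourInd v a) x := by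
  simp [container, hv]

theorem container_congr (v : V) {x y : V → K} (h : ∀ u ∈ F, x u = y u) :
    container μ p θ F v x = container μ p θ F v y := by
  simp only [container, condMean_congr _ h]

/-- Colours excluded from the container have conditional probability below θ p a, hence at most θ in
total. -/
theorem sum_condMean_container_ge (hμ : ∀ x, 0 ≤ μ x) (hp : ∀ a, 0 ≤ p a)
    (hp1 : ∑ a, p a = 1) (hθ : 0 ≤ θ) (v : V) {x : V → K} (hx : 0 < μ x) :
    1 - θ ≤ ∑ a ∈ container μ p θ F v x, condMean μ F (colourInd v a) x := by
  have h1 := sum_condMean_colourInd hμ F v hx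
  by_cases hv : v ∈ F
  · rw [container_of_mem hv, h1]
    linarith
  · rw [← Finset.sum_add_sum_compl (container μ p θ F v x)] at h1
    have h2 : ∑ a ∈ (container μ p θ F v x)ᶜ, condMean μ F (colourInd v a) x ≤ θ := by
      calc _ ≤ ∑ a ∈ (container μ p θ F v x)ᶜ, θ * p a := by
            refine Finset.sum_le_sum fun a ha => ?_
            rw [mem_compl, mem_container hv, not_le] at ha
            exact ha.le
        _ ≤ ∑ a, θ * p a := Finset.sum_le_sum_of_subset_of_nonneg (subset_univ _)
            fun a _ _ => mul_nonneg hθ (hp a)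
        _ = θ := by rw [← Finset.mul_sum, hp1, mul_one]
    linarith

/-- Domination by the product weights makes μ vanish on colourings that use a colour of weight zero.
A container of weight zero would then carry no conditional mass, against the lower bound 1 - θ. -/
theorem weight_container_pos (hμ : ∀ x, 0 ≤ μ x) (hp : ∀ a, 0 ≤ p a) (hp1 : ∑ a, p a = 1)
    (hθ : 0 ≤ θ) (hθ1 : θ < 1) {W : ℝ} (hW : 0 < W) (hWμ : ∀ x, W * μ x ≤ ∏ v, p (x v)) (v : V)
    {x : V → K} (hx : 0 < μ x) : 0 < ∑ a ∈ container μ p θ F v x, p a := by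
  have h1 := sum_condMean_container_ge (F := F) hμ hp hp1 hθ v hx
  refine lt_of_le_of_ne (Finset.sum_nonneg fun a _ => hp a) fun h0 => ?_
  have hz := (Finset.sum_eq_zero_iff_of_nonneg fun a _ => hp a).1 h0.symm
  have : ∑ a ∈ container μ p θ F v x, condMean μ F (colourInd v a) x = 0 := by
    refine Finset.sum_eq_zero fun a ha => ?_
    rw [condMean, Finset.sum_eq_zero, zero_div]
    intro y _
    unfold colourInd
    split_ifs with hya
    · have hy0 : ∏ u, p (y u) = 0 :=
        Finset.prod_eq_zero (mem_univ v) (by rw [hya]; exact hz a ha)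
      have := hWμ y
      rw [hy0] at this
      have hμy : μ y = 0 := le_antisymm (by
        by_contra! h
        have := mul_pos hW h
        linarith) (hμ y)
      rw [hμy, zero_mul]
    · rw [mul_zero]
  linarith

theorem weight_container_le_one (hp : ∀ a, 0 ≤ p a) (hp1 : ∑ a, p a = 1) (v : V) (x : V → K) :
    ∑ a ∈ container μ p θ F v x, p a ≤ 1 := by
  rw [← hp1]
  exact Finset.sum_le_sum_of_subset_of_nonneg (subset_univ _) fun a _ _ => hp a

/-- The entropy of the container at `v`. -/
noncomputable def containerEntropy (μ : (V → K) → ℝ) (p : K → ℝ) (θ : ℝ) (F : Finset V) (v : V)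
    (x : V → K) : ℝ :=
  -Real.log (∑ a ∈ container μ p θ F v x, p a)

theorem containerEntropy_nonneg (hp : ∀ a, 0 ≤ p a) (hp1 : ∑ a, p a = 1) (v : V) (x : V → K) :
    0 ≤ containerEntropy μ p θ F v x :=
  neg_nonneg.2 (Real.log_nonpos (Finset.sum_nonneg fun a _ => hp a)
    (weight_container_le_one hp hp1 v x))

theorem containerEntropy_of_mem (hp1 : ∑ a, p a = 1) {v : V} (hv : v ∈ F) (x : V → K) :
    containerEntropy μ p θ F v x = 0 := by
  rw [containerEntropy, container_of_mem hv, hp1, Real.log_one, neg_zero]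

/-- The density of the uniform distribution on the container at `v`, mixed with a small multiple
of the uniform distribution on all colours. -/
noncomputable def containerDensity (μ : (V → K) → ℝ) (p : K → ℝ) (θ : ℝ) (F : Finset V) (v : V)
    (x : V → K) (a : K) : ℝ :=
  (if a ∈ container μ p θ F v x then (1 - θ) / ∑ b ∈ container μ p θ F v x, p b else 0) + θ

theorem sum_mul_containerDensity_le (hp1 : ∑ a, p a = 1) (hθ1 : θ < 1) (v : V) (x : V → K) :
    ∑ a, p a * containerDensity μ p θ F v x a ≤ 1 := by
  simp only [containerDensity, mul_add, Finset.sum_add_distrib, mul_ite, mul_zero,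
    Finset.sum_ite_mem, univ_inter, ← Finset.sum_mul, hp1, one_mul]
  rw [mul_div_left_comm]
  -- A container of weight zero is also covered, its quotient being 0 by convention.
  have := div_self_le_one (∑ b ∈ container μ p θ F v x, p b)
  nlinarith

theorem sum_mul_indicator_container (hμ : ∀ x, 0 ≤ μ x) (v : V) {h : (V → K) → ℝ}
    (hh : ∀ x y, (∀ u ∈ F, x u = y u) → h x = h y) :
    ∑ x, μ x * ((if x v ∈ container μ p θ F v x then 1 else 0) * h x) =
      ∑ x, μ x * ((∑ a ∈ container μ p θ F v x, condMean μ F (colourInd v a) x) * h x) := by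
  have h1 : ∀ x : V → K, μ x * ((if x v ∈ container μ p θ F v x then 1 else 0) * h x) =
      ∑ a, μ x * colourInd v a x * ((if a ∈ container μ p θ F v x then 1 else 0) * h x) := by
    intro x
    rw [Finset.sum_eq_single (x v)]
    · simp [colourInd]
    · intro a _ ha
      simp [colourInd, Ne.symm ha]
    · simp
  have h2 : ∀ x : V → K,
      μ x * ((∑ a ∈ container μ p θ F v x, condMean μ F (colourInd v a) x) * h x) =
      ∑ a, μ x * condMean μ F (colourInd v a) x *
        ((if a ∈ container μ p θ F v x then 1 else 0) * h x) := by
    intro x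
    simp only [ite_mul, one_mul, zero_mul, mul_ite, mul_zero, Finset.sum_ite_mem, univ_inter]
    rw [Finset.sum_mul, Finset.mul_sum]
    exact Finset.sum_congr rfl fun a _ => by ring
  simp only [h1, h2]
  rw [Finset.sum_comm, Finset.sum_comm (s := univ (α := V → K))]
  refine Finset.sum_congr rfl fun a _ => ?_
  refine (sum_mul_condMean_mul hμ (G := F) (colourInd v a) ?_).symm
  intro x y hxy
  rw [container_congr v hxy, hh x y hxy]

/-- Inside the container the density is at least (1 - θ) over its weight, giving the container
entropy plus log(1 - θ); outside it equals θ. Given F, the second event has probability at most θ,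
so the negative term θ log θ bounds its cost. The admixture of θ is what keeps the logarithm finite.
-/
theorem sum_mul_log_containerDensity_ge (hμ : ∀ x, 0 ≤ μ x) (hμ1 : ∑ x, μ x = 1)
    (hp : ∀ a, 0 ≤ p a) (hp1 : ∑ a, p a = 1) (hθ : 0 < θ) (hθ1 : θ < 1) {W : ℝ} (hW : 0 < W)
    (hWμ : ∀ x, W * μ x ≤ ∏ v, p (x v)) (v : V) :
    (1 - θ) * (∑ x, μ x * containerEntropy μ p θ F v x) + (Real.log (1 - θ) + θ * Real.log θ) ≤
      ∑ x, μ x * Real.log (containerDensity μ p θ F v x (x v)) := by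
  have hlogθ : Real.log θ < 0 := Real.log_neg hθ hθ1
  have hlog1 : Real.log (1 - θ) < 0 := Real.log_neg (by linarith) (by linarith)
  let c : (V → K) → ℝ := fun x => if x v ∈ container μ p θ F v x then 1 else 0
  let C : (V → K) → ℝ := fun x => ∑ a ∈ container μ p θ F v x, condMean μ F (colourInd v a) x
  let s : (V → K) → ℝ := containerEntropy μ p θ F v
  have hs0 : ∀ x, 0 ≤ s x := fun x => containerEntropy_nonneg hp hp1 v x
  have hpt : ∀ x, μ x * (c x * (s x + Real.log (1 - θ) - Real.log θ)) + μ x * Real.log θ ≤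
      μ x * Real.log (containerDensity μ p θ F v x (x v)) := by
    intro x
    rcases (hμ x).eq_or_lt with h0 | h0
    · simp [← h0]
    rw [← mul_add]
    refine mul_le_mul_of_nonneg_left ?_ h0.le
    have hpos := weight_container_pos (F := F) hμ hp hp1 hθ.le hθ1 hW hWμ v h0
    by_cases hx : x v ∈ container μ p θ F v x
    · simp only [c, if_pos hx, one_mul, containerDensity]
      have : s x + Real.log (1 - θ) =
          Real.log ((1 - θ) / ∑ b ∈ container μ p θ F v x, p b) := by
        rw [Real.log_div (by linarith) hpos.ne']
        simp only [s, containerEntropy]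
        ring
      rw [sub_add_cancel, this]
      refine Real.log_le_log (div_pos (by linarith) hpos) (by linarith)
    · simp [c, hx, containerDensity]
  have hdep : ∀ x y : V → K, (∀ u ∈ F, x u = y u) → s x + Real.log (1 - θ) - Real.log θ =
      s y + Real.log (1 - θ) - Real.log θ := by
    intro x y hxy
    simp only [s, containerEntropy, container_congr v hxy]
  have hcC := sum_mul_indicator_container (p := p) (θ := θ) hμ v hdep
  have hC : ∀ x, 0 < μ x → 1 - θ ≤ C x := fun x hx =>
    sum_condMean_container_ge hμ hp hp1 hθ.le v hx
  have hC1 : ∀ x, C x ≤ 1 := fun x =>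
    (Finset.sum_le_sum_of_subset_of_nonneg (subset_univ _)
      fun a _ _ => condMean_colourInd_nonneg hμ F v a x).trans
        (sum_condMean_colourInd_le_one F v x)
  have hpt2 : ∀ x, (1 - θ) * (μ x * s x) + μ x * (Real.log (1 - θ) + θ * Real.log θ) ≤
      μ x * (C x * (s x + Real.log (1 - θ) - Real.log θ)) + μ x * Real.log θ := by
    intro x
    rcases (hμ x).eq_or_lt with h0 | h0
    · simp [← h0]
    have h1 := hC x h0
    have h2 := hC1 x
    have h3 := hs0 x
    have : (1 - θ) * s x + (Real.log (1 - θ) + θ * Real.log θ) ≤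
        C x * (s x + Real.log (1 - θ) - Real.log θ) + Real.log θ := by
      nlinarith
    calc _ = μ x * ((1 - θ) * s x + (Real.log (1 - θ) + θ * Real.log θ)) := by ring
      _ ≤ μ x * (C x * (s x + Real.log (1 - θ) - Real.log θ) + Real.log θ) := by gcongr
      _ = _ := by ring
  calc _ = ∑ x, ((1 - θ) * (μ x * s x) + μ x * (Real.log (1 - θ) + θ * Real.log θ)) := by
        rw [Finset.sum_add_distrib, ← Finset.mul_sum, ← Finset.sum_mul, hμ1, one_mul]
    _ ≤ ∑ x, (μ x * (C x * (s x + Real.log (1 - θ) - Real.log θ)) + μ x * Real.log θ) :=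
        Finset.sum_le_sum fun x _ => hpt2 x
    _ = ∑ x, (μ x * (c x * (s x + Real.log (1 - θ) - Real.log θ)) + μ x * Real.log θ) := by
        rw [Finset.sum_add_distrib, Finset.sum_add_distrib, hcC]
    _ ≤ _ := Finset.sum_le_sum fun x _ => hpt x

/-- If boxes that contain little of `Q` have entropy at least `m`, then the containers of the
vertices have large total entropy. -/
theorem sum_containerEntropy_ge (hμ : ∀ x, 0 ≤ μ x) (hp : ∀ a, 0 ≤ p a) (hp1 : ∑ a, p a = 1)
    (hθ : 0 < θ) (hθ1 : θ < 1) {W : ℝ} (hW : 0 < W) (hWμ : ∀ x, W * μ x ≤ ∏ v, p (x v))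
    {E : Finset (U ↪ V)} {k : ℕ} (hdeg : ∀ v, (E.filter (fun φ => ∃ i, φ i = v)).card = k)
    {Q : Finset (U → K)} {κ m : ℝ} (hκ : 0 < κ) (hm : 0 ≤ m)
    (hbox : ∀ A : U → Finset K, ∑ a ∈ Q with ∀ i, a i ∈ A i, ∏ i, p (a i) ≤ κ →
      ∏ i, ∑ b ∈ A i, p b ≤ Real.exp (-m)) {x : V → K} (hx : 0 < μ x) :
    m * (E.card - k * F.card - (κ * θ ^ Fintype.card U)⁻¹ *
        ∑ φ ∈ E, ∑ a ∈ Q, ∏ i, condMean μ F (colourInd (φ i) (a i)) x) ≤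
      k * ∑ v, containerEntropy μ p θ F v x := by
  set B : (U ↪ V) → ℝ := fun φ => ∑ a ∈ Q, ∏ i, condMean μ F (colourInd (φ i) (a i)) x with hB
  have hB0 : ∀ φ, 0 ≤ B φ := fun φ => Finset.sum_nonneg fun a _ =>
    Finset.prod_nonneg fun i _ => condMean_colourInd_nonneg hμ F _ _ x
  have hedge : ∀ φ : U ↪ V, m * (1 - (∑ i, if φ i ∈ F then (1 : ℝ) else 0) -
      (κ * θ ^ Fintype.card U)⁻¹ * B φ) ≤ ∑ i, containerEntropy μ p θ F (φ i) x := by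
    intro φ
    have hs0 : 0 ≤ ∑ i, containerEntropy μ p θ F (φ i) x :=
      Finset.sum_nonneg fun i _ => containerEntropy_nonneg hp hp1 _ x
    have hinv : 0 ≤ (κ * θ ^ Fintype.card U)⁻¹ * B φ := mul_nonneg (by positivity) (hB0 φ)
    -- An edge meeting F makes the left side nonpositive. For other edges, either the box of
    -- containers has Q-weight at most κ and `hbox` applies, or its Q-weight exceeds κ and the
    -- densities at least θ force B φ ≥ κ θ^r, so the left side is again nonpositive.
    by_cases hF : ∃ i, φ i ∈ F
    · obtain ⟨i, hi⟩ := hF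
      have h1 : (1 : ℝ) ≤ ∑ i, if φ i ∈ F then (1 : ℝ) else 0 := by
        refine le_trans (by simp [hi]) (Finset.single_le_sum
          (f := fun i => if φ i ∈ F then (1 : ℝ) else 0)
          (fun j _ => by positivity) (mem_univ i))
      nlinarith
    push Not at hF
    have h0 : (∑ i, if φ i ∈ F then (1 : ℝ) else 0) = 0 := by simp [hF]
    rw [h0, sub_zero]
    by_cases hQ : ∑ a ∈ Q with ∀ i, a i ∈ container μ p θ F (φ i) x, ∏ i, p (a i) ≤ κ
    · have h2 := hbox _ hQ
      have hpos : ∀ i, 0 < ∑ b ∈ container μ p θ F (φ i) x, p b := fun i =>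
        weight_container_pos hμ hp hp1 hθ.le hθ1 hW hWμ (φ i) hx
      have h3 : Real.log (∏ i, ∑ b ∈ container μ p θ F (φ i) x, p b) ≤ -m := by
        rw [← Real.log_exp (-m)]
        exact Real.log_le_log (Finset.prod_pos fun i _ => hpos i) h2
      rw [Real.log_prod (fun i _ => (hpos i).ne')] at h3
      have h4 : ∑ i, containerEntropy μ p θ F (φ i) x =
          -∑ i, Real.log (∑ b ∈ container μ p θ F (φ i) x, p b) := by
        simp [containerEntropy]
      rw [h4]
      nlinarith
    · push Not at hQ
      have h2 : θ ^ Fintype.card U *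
          ∑ a ∈ Q with ∀ i, a i ∈ container μ p θ F (φ i) x, ∏ i, p (a i) ≤ B φ := by
        rw [Finset.mul_sum]
        refine le_trans (Finset.sum_le_sum fun a ha => ?_)
          (Finset.sum_le_sum_of_subset_of_nonneg (filter_subset _ _) fun a _ _ =>
            Finset.prod_nonneg fun i _ => condMean_colourInd_nonneg hμ F _ _ x)
        have hmem := (mem_filter.1 ha).2
        calc θ ^ Fintype.card U * ∏ i, p (a i) = ∏ i, θ * p (a i) := by
              rw [Finset.prod_mul_distrib]; simp
          _ ≤ _ := Finset.prod_le_prod (fun i _ => mul_nonneg hθ.le (hp _)) fun i _ =>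
              (mem_container (hF i) x (a i)).1 (hmem i)
      have hθr : 0 < θ ^ Fintype.card U := by positivity
      have h3 : κ * θ ^ Fintype.card U ≤ B φ := by
        refine le_trans ?_ h2
        rw [mul_comm]
        exact mul_le_mul_of_nonneg_left hQ.le hθr.le
      have h4 : 1 ≤ (κ * θ ^ Fintype.card U)⁻¹ * B φ := by
        rw [inv_mul_eq_div, one_le_div (by positivity)]
        exact h3
      nlinarith
  rw [← sum_sum_apply_eq hdeg]
  have hFsum : ∑ φ ∈ E, (∑ i, if φ i ∈ F then (1 : ℝ) else 0) = k * F.card := by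
    rw [sum_sum_apply_eq hdeg (fun v => if v ∈ F then (1 : ℝ) else 0)]
    simp
  calc _ = ∑ φ ∈ E, m * (1 - (∑ i, if φ i ∈ F then (1 : ℝ) else 0) -
      (κ * θ ^ Fintype.card U)⁻¹ * B φ) := by
        rw [← Finset.mul_sum, Finset.sum_sub_distrib, Finset.sum_sub_distrib, hFsum,
          ← Finset.mul_sum]
        simp
    _ ≤ _ := Finset.sum_le_sum fun φ _ => hedge φ

/-- Lower bound for `-log W` in terms of the number of edges whose colours are nearly
independent. -/
theorem neg_log_ge_of_containers (hμ : ∀ x, 0 ≤ μ x) (hμ1 : ∑ x, μ x = 1) (hp : ∀ a, 0 ≤ p a)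
    (hp1 : ∑ a, p a = 1) (hθ : 0 < θ) (hθ1 : θ < 1) {W : ℝ} (hW : 0 < W)
    (hWμ : ∀ x, W * μ x ≤ ∏ v, p (x v))
    {E : Finset (U ↪ V)} {k : ℕ} (hk : 0 < k)
    (hdeg : ∀ v, (E.filter (fun φ => ∃ i, φ i = v)).card = k)
    {Q : Finset (U → K)} {κ m : ℝ} (hκ : 0 < κ) (hm : 0 ≤ m)
    (hbox : ∀ A : U → Finset K, ∑ a ∈ Q with ∀ i, a i ∈ A i, ∏ i, p (a i) ≤ κ →
      ∏ i, ∑ b ∈ A i, p b ≤ Real.exp (-m)) (F : Finset V) :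
    (1 - θ) * (m / k) * (E.card - k * F.card - (κ * θ ^ Fintype.card U)⁻¹ *
        ∑ φ ∈ E, ∑ x, μ x * ∑ a ∈ Q, ∏ i, condMean μ F (colourInd (φ i) (a i)) x) +
      Fintype.card V * (Real.log (1 - θ) + θ * Real.log θ) ≤ -Real.log W := by
  have hlogθ : Real.log θ < 0 := Real.log_neg hθ hθ1
  have hlog1 : Real.log (1 - θ) < 0 := Real.log_neg (by linarith) (by linarith)
  have hψ : Real.log (1 - θ) + θ * Real.log θ ≤ 0 := by nlinarith
  have hgibbs := sum_mul_log_density_le hp hp1 (F := F) (ℓ := containerDensity μ p θ F)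
    (fun v x a => by
      unfold containerDensity
      have : 0 ≤ ∑ b ∈ container μ p θ F v x, p b := Finset.sum_nonneg fun b _ => hp b
      have h1 : 0 ≤ 1 - θ := by linarith
      split_ifs <;> positivity)
    (fun v x y h => by
      ext a
      simp only [containerDensity, container_congr v h])
    (fun v x => sum_mul_containerDensity_le hp1 hθ1 v x) hμ hμ1 hW hWμ
  refine le_trans ?_ hgibbs
  have hstep : (1 - θ) * ∑ x, μ x * ∑ v, containerEntropy μ p θ F v x +
      Fintype.card V * (Real.log (1 - θ) + θ * Real.log θ) ≤
      ∑ x, μ x * ∑ v ∈ Fᶜ, Real.log (containerDensity μ p θ F v x (x v)) := by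
    have h1 : ∑ x, μ x * ∑ v, containerEntropy μ p θ F v x =
        ∑ v ∈ Fᶜ, ∑ x, μ x * containerEntropy μ p θ F v x := by
      rw [Finset.sum_comm]
      refine Finset.sum_congr rfl fun x _ => ?_
      rw [← Finset.mul_sum, ← Finset.sum_compl_add_sum F,
        Finset.sum_eq_zero (s := F) fun v hv => containerEntropy_of_mem hp1 hv x, add_zero]
    have h2 : ∑ x, μ x * ∑ v ∈ Fᶜ, Real.log (containerDensity μ p θ F v x (x v)) =
        ∑ v ∈ Fᶜ, ∑ x, μ x * Real.log (containerDensity μ p θ F v x (x v)) := by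
      simp only [Finset.mul_sum]
      rw [Finset.sum_comm]
    rw [h1, h2, Finset.mul_sum]
    have h3 : Fintype.card V * (Real.log (1 - θ) + θ * Real.log θ) ≤
        ∑ v ∈ Fᶜ, (Real.log (1 - θ) + θ * Real.log θ) := by
      rw [sum_const, nsmul_eq_mul]
      refine mul_le_mul_of_nonpos_right ?_ hψ
      exact_mod_cast card_le_univ _
    calc _ ≤ ∑ v ∈ Fᶜ, (1 - θ) * ∑ x, μ x * containerEntropy μ p θ F v x +
          ∑ v ∈ Fᶜ, (Real.log (1 - θ) + θ * Real.log θ) := by linarith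
      _ ≤ _ := by
          rw [← Finset.sum_add_distrib]
          exact Finset.sum_le_sum fun v _ =>
            sum_mul_log_containerDensity_ge hμ hμ1 hp hp1 hθ hθ1 hW hWμ v
  refine le_trans ?_ hstep
  have hk' : (0 : ℝ) < k := by exact_mod_cast hk
  have hsum : m * (E.card - k * F.card - (κ * θ ^ Fintype.card U)⁻¹ *
        ∑ φ ∈ E, ∑ x, μ x * ∑ a ∈ Q, ∏ i, condMean μ F (colourInd (φ i) (a i)) x) ≤
      k * ∑ x, μ x * ∑ v, containerEntropy μ p θ F v x := by
    have h1 : ∀ x, μ x * (m * (E.card - k * F.card - (κ * θ ^ Fintype.card U)⁻¹ *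
        ∑ φ ∈ E, ∑ a ∈ Q, ∏ i, condMean μ F (colourInd (φ i) (a i)) x)) ≤
        μ x * (k * ∑ v, containerEntropy μ p θ F v x) := by
      intro x
      rcases (hμ x).eq_or_lt with h0 | h0
      · simp [← h0]
      exact mul_le_mul_of_nonneg_left
        (sum_containerEntropy_ge hμ hp hp1 hθ hθ1 hW hWμ hdeg hκ hm hbox h0) h0.le
    have h2 := Finset.sum_le_sum fun x (_ : x ∈ univ) => h1 x
    have h3 : ∑ φ ∈ E, ∑ x, μ x * ∑ a ∈ Q, ∏ i, condMean μ F (colourInd (φ i) (a i)) x =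
        ∑ x, μ x * ∑ φ ∈ E, ∑ a ∈ Q, ∏ i, condMean μ F (colourInd (φ i) (a i)) x := by
      rw [Finset.sum_comm]
      simp only [Finset.mul_sum]
    have h4 : ∀ (c : ℝ) (B : (V → K) → ℝ), ∑ x, μ x * (m * (c - (κ * θ ^ Fintype.card U)⁻¹ * B x))
        = m * (c - (κ * θ ^ Fintype.card U)⁻¹ * ∑ x, μ x * B x) := by
      intro c B
      have : ∀ x, μ x * (m * (c - (κ * θ ^ Fintype.card U)⁻¹ * B x)) =
          m * c * μ x - m * (κ * θ ^ Fintype.card U)⁻¹ * (μ x * B x) := fun x => by ring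
      simp only [this, Finset.sum_sub_distrib, ← Finset.mul_sum, hμ1]
      ring
    rw [h4, ← h3] at h2
    refine h2.trans (le_of_eq ?_)
    rw [Finset.mul_sum]
    exact Finset.sum_congr rfl fun x _ => by ring
  have h5 := mul_le_mul_of_nonneg_left hsum (div_nonneg (by linarith : 0 ≤ 1 - θ) hk'.le)
  have h6 : (1 - θ) / k * (k * ∑ x, μ x * ∑ v, containerEntropy μ p θ F v x) =
      (1 - θ) * ∑ x, μ x * ∑ v, containerEntropy μ p θ F v x := by
    field_simp
  rw [h6] at h5
  refine add_le_add_left (le_trans (le_of_eq ?_) h5) _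
  ring

end Containers

/-! ### The container bound for finitely many colours. -/

section FiniteBound

open Finset

variable {V K U : Type*} [Fintype V] [Fintype K] [Fintype U] [DecidableEq V] [DecidableEq K]
  [DecidableEq U]

theorem sum_sum_sqrt_le {ι : Type*} (E : Finset ι) {w : ι → U → ℝ} (hw : ∀ φ i, 0 ≤ w φ i) {τ : ℝ}
    (hτ : ∑ φ ∈ E, ∑ i, w φ i ≤ τ * E.card) :
    ∑ φ ∈ E, ∑ i, √(w φ i) ≤ √(Fintype.card U * τ) * E.card := by
  have hE : √((E.card : ℝ) ^ 2) = E.card := Real.sqrt_sq (by positivity)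
  calc _ ≤ √((E.card * Fintype.card U : ℝ) * (τ * E.card)) := by
        refine Real.le_sqrt_of_sq_le ?_
        calc (∑ φ ∈ E, ∑ i, √(w φ i)) ^ 2 = (∑ z ∈ E ×ˢ univ, √(w z.1 z.2)) ^ 2 := by
              rw [Finset.sum_product]
          _ ≤ (E ×ˢ (univ : Finset U)).card * ∑ z ∈ E ×ˢ univ, √(w z.1 z.2) ^ 2 :=
              sq_sum_le_card_mul_sum_sq
          _ = (E.card * Fintype.card U : ℝ) * ∑ φ ∈ E, ∑ i, w φ i := by
              rw [Finset.sum_product, Finset.card_product]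
              simp only [Real.sq_sqrt (hw _ _)]
              push_cast [card_univ]
              rfl
          _ ≤ _ := by gcongr
    _ = _ := by
        rw [show (E.card * Fintype.card U : ℝ) * (τ * E.card) =
          (Fintype.card U * τ) * (E.card : ℝ) ^ 2 by ring]
        rw [Real.sqrt_mul' _ (by positivity), hE]

/-- The finite form of the container bound: a set of colourings of relative size `W` whose members
have, on average, few edges coloured from `Q` satisfies a lower bound on `-log W`. -/
theorem neg_log_ge_of_regular {μ : (V → K) → ℝ} {p : K → ℝ} {θ : ℝ}
    (hμ : ∀ x, 0 ≤ μ x) (hμ1 : ∑ x, μ x = 1) (hp : ∀ a, 0 ≤ p a)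
    (hp1 : ∑ a, p a = 1) (hθ : 0 < θ) (hθ1 : θ < 1) {W : ℝ} (hW : 0 < W)
    (hWμ : ∀ x, W * μ x ≤ ∏ v, p (x v))
    {E : Finset (U ↪ V)} {k : ℕ} (hk : 0 < k)
    (hdeg : ∀ v, (E.filter (fun φ => ∃ i, φ i = v)).card = k) (hU : 0 < Fintype.card U)
    {Q : Finset (U → K)} {κ m δ c τ : ℝ} (hκ : 0 < κ) (hm : 0 ≤ m) (hc : 0 < c) (hτ : 0 ≤ τ)
    (hbox : ∀ A : U → Finset K, ∑ a ∈ Q with ∀ i, a i ∈ A i, ∏ i, p (a i) ≤ κ →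
      ∏ i, ∑ b ∈ A i, p b ≤ Real.exp (-m))
    (hδ : ∑ φ ∈ E, ∑ x, μ x * (if x ∘ φ ∈ Q then 1 else 0) ≤ δ * E.card) (M : ℕ)
    (hM : c * Fintype.card V * (M + 1 : ℝ)⁻¹ * ((k : ℝ) ^ 2 * Fintype.card V +
          (M + 1 : ℝ) ^ (2 * (Fintype.card U - 1)) *
          (Fintype.card U * (((E ×ˢ E).filter fun p => 1 < (univ.map p.1 ∩ univ.map p.2).card ∧
              (univ.map p.1 ∩ univ.map p.2).card < Fintype.card U).card +
            E.card * (Fintype.card U : ℝ) ^ Fintype.card U))) ≤ (τ * E.card) ^ 2) :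
    Fintype.card V * ((1 - θ) * (m / Fintype.card U) * (1 - Fintype.card U / c -
      (κ * θ ^ Fintype.card U)⁻¹ * (δ + (Fintype.card K : ℝ) ^ Fintype.card U *
        √(Fintype.card U * τ))) + (Real.log (1 - θ) + θ * Real.log θ)) ≤ -Real.log W := by
  obtain ⟨F, hFc, hF⟩ := exists_pinning_set hdeg (g := colourEnergy μ) (colourEnergy_mono hμ)
    (colourEnergy_nonneg hμ) (colourEnergy_le_one hμ hμ1) hc M
  refine le_trans ?_ (neg_log_ge_of_containers hμ hμ1 hp hp1 hθ hθ1 hW hWμ hk hdeg hκ hm hbox F)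
  have hw : ∑ φ ∈ E, ∑ i, (colourEnergy μ (φ i) (F ∪ (univ.erase i).map φ) -
      colourEnergy μ (φ i) F) ≤ τ * E.card :=
    le_of_sq_le_sq (hF.trans hM) (by positivity)
  have hsqrt := sum_sum_sqrt_le E (fun φ i => sub_nonneg.2
    (colourEnergy_mono hμ (φ i) (subset_union_left (s₁ := F) (s₂ := (univ.erase i).map φ)))) hw
  have hB : ∑ φ ∈ E, ∑ x, μ x * ∑ a ∈ Q, ∏ i, condMean μ F (colourInd (φ i) (a i)) x ≤
      (δ + (Fintype.card K : ℝ) ^ Fintype.card U * √(Fintype.card U * τ)) * E.card := by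
    calc _ ≤ ∑ φ ∈ E, ((∑ x, μ x * if x ∘ φ ∈ Q then 1 else 0) +
          (Fintype.card K : ℝ) ^ Fintype.card U * ∑ i, √(colourEnergy μ (φ i)
            (F ∪ (univ.erase i).map φ) - colourEnergy μ (φ i) F)) :=
          Finset.sum_le_sum fun φ _ => sum_mul_sum_prod_condMean_le hμ hμ1 F φ Q
      _ ≤ δ * E.card + (Fintype.card K : ℝ) ^ Fintype.card U *
          (√(Fintype.card U * τ) * E.card) := by
          rw [Finset.sum_add_distrib, ← Finset.mul_sum]
          gcongr
      _ = _ := by ring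
  set B := ∑ φ ∈ E, ∑ x, μ x * ∑ a ∈ Q, ∏ i, condMean μ F (colourInd (φ i) (a i)) x
  have hcard := card_mul_card_eq hdeg
  have hk' : (0 : ℝ) < k := by exact_mod_cast hk
  have hr : (0 : ℝ) < Fintype.card U := by exact_mod_cast hU
  set r : ℝ := (Fintype.card U : ℝ)
  set D := δ + (Fintype.card K : ℝ) ^ Fintype.card U * √(r * τ)
  have hinv : 0 ≤ (κ * θ ^ Fintype.card U)⁻¹ := by positivity
  -- The number of edges meeting F is at most k|F|, and |F| ≤ |V|/c together with r|E| = k|V| makes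
  -- this a proportion r/c of all edges.
  have hkF : k * F.card ≤ r / c * E.card := by
    have : (F.card : ℝ) ≤ Fintype.card V / c := by
      rw [le_div_iff₀ hc, mul_comm]; exact hFc
    calc (k : ℝ) * F.card ≤ k * (Fintype.card V / c) := by gcongr
      _ = r / c * E.card := by
        rw [← mul_div_assoc, ← hcard]; ring
  have h1 : E.card * (1 - r / c - (κ * θ ^ Fintype.card U)⁻¹ * D) ≤
      E.card - k * F.card - (κ * θ ^ Fintype.card U)⁻¹ * B := by
    have := mul_le_mul_of_nonneg_left hB hinv
    linarith
  have h2 : 0 ≤ (1 - θ) * (m / k) :=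
    mul_nonneg (by linarith) (by positivity)
  have h3 := mul_le_mul_of_nonneg_left h1 h2
  have h4 : (1 - θ) * (m / k) * (E.card * (1 - r / c - (κ * θ ^ Fintype.card U)⁻¹ * D)) =
      Fintype.card V * ((1 - θ) * (m / r) * (1 - r / c - (κ * θ ^ Fintype.card U)⁻¹ * D)) := by
    have : (E.card : ℝ) = k * Fintype.card V / r := by
      rw [← hcard]; field_simp
    rw [this]
    field_simp
  rw [mul_add, ← h4]
  linarith

end FiniteBound

/-! ### Exponential moments of edge counts. -/

section Moment

open scoped ENNReal

variable {U V X : Type*} [Fintype U] [Fintype V] [DecidableEq V] [MeasurableSpace X]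
  {μ : Measure X} [IsProbabilityMeasure μ]

/-- Injectivity is essential: distinct indices of U read distinct, hence independent, coordinates.
-/
theorem measurePreserving_comp_embedding (φ : U ↪ V) :
    MeasurePreserving (fun c : V → X => c ∘ φ) (Measure.pi fun _ => μ)
      (Measure.pi fun _ => μ) := by
  refine ⟨measurable_pi_iff.2 fun i => measurable_pi_apply (φ i), ?_⟩
  have hind : ProbabilityTheory.iIndepFun (fun (v : V) (c : V → X) => c v)
      (Measure.pi fun _ => μ) :=
    ProbabilityTheory.iIndepFun_pi (X := fun _ => id) (fun _ => aemeasurable_id)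
  have h := (ProbabilityTheory.iIndepFun_iff_map_fun_eq_pi_map
    (fun i => (measurable_pi_apply (φ i)).aemeasurable)).1 (hind.precomp φ.injective)
  refine Eq.trans h ?_
  congr 1
  ext1 i
  exact (measurePreserving_eval (fun _ : V => μ) (φ i)).map_eq

/-- Exponential moments of the number of edges on which a point lies in a given small set. -/
theorem lintegral_exp_count_le {E : Finset (U ↪ V)} {k : ℕ} (hk : 0 < k)
    (hdeg : ∀ v, (E.filter (fun φ => ∃ i, φ i = v)).card = k) {B : Set (U → X)}
    (hB : MeasurableSet B) {ε l : ℝ} (hBε : (Measure.pi fun _ : U => μ).real B ≤ ε) :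
    ∫⁻ c, ENNReal.ofReal (Real.exp (l / k * ∑ φ ∈ E, B.indicator 1 (c ∘ φ)))
        ∂(Measure.pi fun _ : V => μ) ≤
      ENNReal.ofReal (Real.exp (Real.exp l * ε * E.card / k)) := by
  classical
  have hk' : (0 : ℝ) < k := by exact_mod_cast hk
  have hε : 0 ≤ ε := measureReal_nonneg.trans hBε
  -- The exponential of the edge count is a product over edges of f to the power 1/k, the shape
  -- required by Finner's inequality. The integral of f is at most 1 + e^l ε ≤ exp(e^l ε).
  let f : (U → X) → ℝ≥0∞ := fun y => ENNReal.ofReal (Real.exp (l * B.indicator 1 y))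
  have hf : Measurable f := by
    refine ENNReal.measurable_ofReal.comp (Real.measurable_exp.comp ?_)
    exact (measurable_one.indicator hB).const_mul l
  have hpt : ∀ c : V → X,
      ENNReal.ofReal (Real.exp (l / k * ∑ φ ∈ E, B.indicator 1 (c ∘ φ))) =
      ∏ φ ∈ E, f (c ∘ φ) ^ (1 / k : ℝ) := by
    intro c
    rw [Finset.mul_sum, Real.exp_sum, ENNReal.ofReal_prod_of_nonneg fun φ _ => (Real.exp_pos _).le]
    refine Finset.prod_congr rfl fun φ _ => ?_
    rw [ENNReal.ofReal_rpow_of_pos (Real.exp_pos _), ← Real.exp_mul]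
    congr 2
    ring
  have hinteg : ∫⁻ y, f y ∂(Measure.pi fun _ : U => μ) ≤
      ENNReal.ofReal (Real.exp (Real.exp l * ε)) := by
    have hfle : ∀ y, f y ≤ 1 + B.indicator (fun _ => ENNReal.ofReal (Real.exp l)) y := by
      intro y
      by_cases hy : y ∈ B
      · simp [f, hy]
      · simp [f, hy]
    calc _ ≤ ∫⁻ y, (1 + B.indicator (fun _ => ENNReal.ofReal (Real.exp l)) y)
            ∂(Measure.pi fun _ : U => μ) := lintegral_mono hfle
      _ = 1 + ENNReal.ofReal (Real.exp l) * (Measure.pi fun _ : U => μ) B := by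
          rw [lintegral_add_left measurable_const, lintegral_indicator_const hB]
          simp
      _ ≤ 1 + ENNReal.ofReal (Real.exp l) * ENNReal.ofReal ε := by
          gcongr
          rw [← ENNReal.ofReal_toReal (measure_ne_top (Measure.pi fun _ : U => μ) B)]
          exact ENNReal.ofReal_le_ofReal hBε
      _ = ENNReal.ofReal (1 + Real.exp l * ε) := by
          rw [ENNReal.ofReal_add zero_le_one (by positivity), ENNReal.ofReal_one,
            ENNReal.ofReal_mul (Real.exp_pos _).le]
      _ ≤ _ := by
          refine ENNReal.ofReal_le_ofReal ?_
          rw [add_comm]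
          exact Real.add_one_le_exp _
  simp only [hpt]
  have hfin := lintegral_prod_rpow_le_of_cover (μ := μ) E (fun φ => Finset.univ.map φ)
    (f := fun φ c => f (c ∘ φ))
    (fun φ => hf.comp (measurePreserving_comp_embedding (μ := μ) φ).measurable)
    (fun φ v hv x y => by
      congr 1
      ext i
      simp only [Function.comp_apply]
      rw [Function.update_of_ne]
      rintro rfl
      exact hv (by simp))
    hk (fun v => by rw [← hdeg v]; congr 1; ext φ; simp)
  refine hfin.trans ?_
  calc _ ≤ ∏ φ ∈ E, ENNReal.ofReal (Real.exp (Real.exp l * ε)) ^ (1 / k : ℝ) := by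
        refine Finset.prod_le_prod' fun φ _ => ?_
        refine ENNReal.rpow_le_rpow ?_ (by positivity)
        rw [(measurePreserving_comp_embedding (μ := μ) φ).lintegral_comp hf]
        exact hinteg
    _ = _ := by
        rw [Finset.prod_const, ENNReal.ofReal_rpow_of_pos (Real.exp_pos _), ← Real.exp_mul,
          ← ENNReal.ofReal_pow (Real.exp_pos _).le, ← Real.exp_nat_mul]
        congr 2
        ring

/-- On a set of not too small measure, the average number of edges on which a point lies in a given
very small set is small. -/
theorem sum_measureReal_inter_le {E : Finset (U ↪ V)} {k : ℕ} (hk : 0 < k)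
    (hdeg : ∀ v, (E.filter (fun φ => ∃ i, φ i = v)).card = k) {B : Set (U → X)}
    (hB : MeasurableSet B) {ε l : ℝ} (hBε : (Measure.pi fun _ : U => μ).real B ≤ ε)
    (S : Set (V → X)) (hS : 0 < (Measure.pi fun _ : V => μ).real S) :
    l / k * ∑ φ ∈ E, (Measure.pi fun _ : V => μ).real ({c | c ∘ φ ∈ B} ∩ S) ≤
      (Measure.pi fun _ : V => μ).real S * (-Real.log ((Measure.pi fun _ : V => μ).real S) +
        Real.exp l * ε * E.card / k) := by
  set m := Measure.pi fun _ : V => μ with hm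
  set W := m.real S with hW
  set y := Real.exp l * ε * E.card / k with hy
  have hBφ : ∀ φ : U ↪ V, MeasurableSet {c : V → X | c ∘ φ ∈ B} := fun φ =>
    (measurePreserving_comp_embedding (μ := μ) φ).measurable hB
  let h : (V → X) → ℝ := fun c => l / k * ∑ φ ∈ E, B.indicator 1 (c ∘ φ)
  have hind : ∀ φ : U ↪ V, (fun c : V → X => B.indicator (1 : (U → X) → ℝ) (c ∘ φ)) =
      {c : V → X | c ∘ φ ∈ B}.indicator 1 := by
    intro φ
    ext c
    simp [Set.indicator]
  have hindm : ∀ φ : U ↪ V,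
      Measurable (fun c : V → X => B.indicator (1 : (U → X) → ℝ) (c ∘ φ)) := fun φ => by
    rw [hind]
    exact measurable_one.indicator (hBφ φ)
  have hhm : Measurable h := (Finset.measurable_sum _ fun φ _ => hindm φ).const_mul _
  have hexp := lintegral_exp_count_le (μ := μ) (l := l) hk hdeg hB hBε
  have hexpint : Integrable (fun c => Real.exp (h c)) m := by
    refine ⟨(Real.measurable_exp.comp hhm).aestronglyMeasurable, ?_⟩
    rw [hasFiniteIntegral_iff_ofReal (Eventually.of_forall fun c => (Real.exp_pos _).le)]
    exact hexp.trans_lt ENNReal.ofReal_lt_top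
  have hexpr : ∫ c, Real.exp (h c) ∂m ≤ Real.exp y := by
    rw [integral_eq_lintegral_of_nonneg_ae (Eventually.of_forall fun c => (Real.exp_pos _).le)
      hexpint.1]
    exact ENNReal.toReal_le_of_le_ofReal (Real.exp_pos _).le hexp
  have hexpS : ∫ c in S, Real.exp (h c) ∂m ≤ Real.exp y :=
    (setIntegral_le_integral hexpint (Eventually.of_forall fun c => (Real.exp_pos _).le)).trans hexpr
  have hindint : ∀ φ : U ↪ V,
      Integrable (fun c : V → X => B.indicator (1 : (U → X) → ℝ) (c ∘ φ)) (m.restrict S) := by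
    intro φ
    rw [hind]
    exact (integrable_const (1 : ℝ)).indicator (hBφ φ)
  have hinteg : Integrable h (m.restrict S) :=
    (integrable_finsetSum _ fun φ _ => hindint φ).const_mul _
  have hlhs : ∫ c in S, h c ∂m = l / k * ∑ φ ∈ E, m.real ({c | c ∘ φ ∈ B} ∩ S) := by
    rw [integral_const_mul, integral_finsetSum _ fun φ _ => hindint φ]
    congr 1
    refine Finset.sum_congr rfl fun φ _ => ?_
    rw [hind, integral_indicator_one (hBφ φ), measureReal_restrict_apply (hBφ φ)]
  rw [← hlhs]
  -- T bounds the mean of exp h on S, so linearizing log at T loses nothing: this is Jensen's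
  -- inequality written pointwise.
  let T : ℝ := Real.exp y / W
  have hT : 0 < T := by positivity
  have hlogT : Real.log T = -Real.log W + y := by
    rw [Real.log_div (Real.exp_pos _).ne' hS.ne', Real.log_exp]
    ring
  have hpt : ∀ c, h c ≤ (Real.log T - 1) + Real.exp (h c) / T := by
    intro c
    have h1 := Real.log_le_sub_one_of_pos (div_pos (Real.exp_pos (h c)) hT)
    rw [Real.log_div (Real.exp_pos _).ne' hT.ne', Real.log_exp] at h1
    linarith
  calc ∫ c in S, h c ∂m ≤ ∫ c in S, ((Real.log T - 1) + Real.exp (h c) / T) ∂m :=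
        integral_mono hinteg
          ((integrable_const _).add (hexpint.restrict.div_const T)) hpt
    _ = W * (Real.log T - 1) + (∫ c in S, Real.exp (h c) ∂m) / T := by
        rw [integral_add (integrable_const _) (hexpint.restrict.div_const T), integral_div]
        simp [hW]
    _ ≤ W * (Real.log T - 1) + Real.exp y / T := by gcongr
    _ = _ := by
        rw [hlogT]
        simp only [T]
        field_simp
        ring

end Moment

/-! ### Passing from measurable sets to cells. -/

section Cells

open Finset
open scoped symmDiff

variable {U V X K : Type*} [Fintype U] [Fintype V] [Fintype K] [DecidableEq U] [DecidableEq V] [DecidableEq K]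
  [MeasurableSpace X] {μ : Measure X} [IsProbabilityMeasure μ]

theorem measurableSet_comp_eq {q : X → K} (hq : ∀ a, MeasurableSet (q ⁻¹' {a})) (x : V → K) :
    MeasurableSet ((fun c : V → X => q ∘ c) ⁻¹' {x}) := by
  have : (fun c : V → X => q ∘ c) ⁻¹' {x} = Set.univ.pi fun v => q ⁻¹' {x v} := by
    ext c
    simp [funext_iff]
  rw [this]
  exact MeasurableSet.univ_pi fun v => hq _

theorem measureReal_comp_eq (q : X → K) (x : V → K) :
    (Measure.pi fun _ : V => μ).real ((fun c : V → X => q ∘ c) ⁻¹' {x}) =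
      ∏ v, μ.real (q ⁻¹' {x v}) := by
  have : (fun c : V → X => q ∘ c) ⁻¹' {x} = Set.univ.pi fun v => q ⁻¹' {x v} := by
    ext c
    simp [funext_iff]
  rw [this, measureReal_def, Measure.pi_pi, ENNReal.toReal_prod]
  rfl

theorem measureReal_preimage_finset {q : X → K} (hq : ∀ a, MeasurableSet (q ⁻¹' {a}))
    (A : Finset K) : μ.real (q ⁻¹' A) = ∑ a ∈ A, μ.real (q ⁻¹' {a}) :=
  (sum_measureReal_preimage_singleton A fun a _ => hq a).symm

theorem sum_measureReal_cell {q : X → K} (hq : ∀ a, MeasurableSet (q ⁻¹' {a})) :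
    ∑ a, μ.real (q ⁻¹' {a}) = 1 := by
  rw [← measureReal_preimage_finset hq]
  simp

theorem measureReal_pi_preimage_finset (q : X → K) (A : V → Finset K) :
    (Measure.pi fun _ : V => μ).real (Set.univ.pi fun v => q ⁻¹' (A v)) =
      ∏ v, μ.real (q ⁻¹' (A v)) := by
  rw [measureReal_def, Measure.pi_pi, ENNReal.toReal_prod]
  rfl

/-- Cell boxes which contain little of `Q` have small weight. -/
theorem prod_sum_cell_le {P : Set (U → X)} {κ m : ℝ}
    (hbox : ∀ A : U → Set X, (∀ i, MeasurableSet (A i)) →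
      Measure.pi (fun _ : U => μ) (Set.univ.pi A \ P) ≤ ENNReal.ofReal κ →
      Measure.pi (fun _ : U => μ) (Set.univ.pi A) < ENNReal.ofReal (Real.exp (-m)))
    {q : X → K} (hq : ∀ a, MeasurableSet (q ⁻¹' {a})) {Q : Finset (U → K)}
    (hQ : (Measure.pi fun _ : U => μ).real ({c | q ∘ c ∈ Q} ∆ Pᶜ) ≤ κ / 2) (A : U → Finset K)
    (hA : ∑ a ∈ Q with ∀ i, a i ∈ A i, ∏ i, μ.real (q ⁻¹' {a i}) ≤ κ / 2) :
    ∏ i, ∑ b ∈ A i, μ.real (q ⁻¹' {b}) ≤ Real.exp (-m) := by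
  have hqA : ∀ A : Finset K, MeasurableSet (q ⁻¹' A) := by
    intro A
    have : q ⁻¹' A = ⋃ a ∈ A, q ⁻¹' {a} := by ext; simp
    rw [this]
    exact Finset.measurableSet_biUnion _ fun a _ => hq a
  set mU := Measure.pi fun _ : U => μ with hmU
  have h1 : mU.real (Set.univ.pi (fun i => q ⁻¹' (A i)) \ P) ≤ κ := by
    calc _ ≤ mU.real ((fun c : U → X => q ∘ c) ⁻¹' (Q.filter fun a => ∀ i, a i ∈ A i) ∪
          ({c | q ∘ c ∈ Q} ∆ Pᶜ)) := by
          refine measureReal_mono ?_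
          rintro c ⟨hc, hcP⟩
          by_cases hcQ : q ∘ c ∈ Q
          · left
            simp only [Set.mem_preimage, Finset.coe_filter, Set.mem_ofPred_eq]
            exact ⟨hcQ, fun i => hc i (Set.mem_univ i)⟩
          · right
            exact Or.inr ⟨hcP, hcQ⟩
      -- Half of κ pays for the Q-weight of the cell box, half for the approximation of the
      -- complement of P.
      _ ≤ κ / 2 + κ / 2 := by
          refine (measureReal_union_le _ _).trans (add_le_add ?_ hQ)
          rw [← sum_measureReal_preimage_singleton _ fun a _ => measurableSet_comp_eq hq a]
          refine le_trans (le_of_eq ?_) hA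
          exact Finset.sum_congr rfl fun a _ => measureReal_comp_eq q a
      _ = κ := by ring
  have hκ : 0 ≤ κ := measureReal_nonneg.trans h1
  have h2 := hbox (fun i => q ⁻¹' (A i)) (fun i => hqA _)
    ((ENNReal.le_ofReal_iff_toReal_le (measure_ne_top _ _) hκ).2 h1)
  have h3 : mU.real (Set.univ.pi fun i => q ⁻¹' (A i)) ≤ Real.exp (-m) :=
    ENNReal.toReal_le_of_le_ofReal (Real.exp_pos _).le h2.le
  rw [hmU, measureReal_pi_preimage_finset] at h3
  simpa only [measureReal_preimage_finset hq] using h3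

/-- The law of the cells of a uniform random point of `S`. -/
noncomputable def cellLaw (m : Measure (V → X)) (S : Set (V → X)) (q : X → K) (x : V → K) : ℝ :=
  m.real (((fun c : V → X => q ∘ c) ⁻¹' {x}) ∩ S) / m.real S

theorem sum_cellLaw_filter {m : Measure (V → X)} [IsFiniteMeasure m] {S : Set (V → X)} {q : X → K}
    (hq : ∀ a, MeasurableSet (q ⁻¹' {a})) (T : Finset (V → K)) :
    ∑ x ∈ T, cellLaw m S q x = m.real (((fun c : V → X => q ∘ c) ⁻¹' T) ∩ S) / m.real S := by
  have hT : MeasurableSet ((fun c : V → X => q ∘ c) ⁻¹' T) := by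
    have : (fun c : V → X => q ∘ c) ⁻¹' T = ⋃ a ∈ T, (fun c : V → X => q ∘ c) ⁻¹' {a} := by
      ext; simp
    rw [this]
    exact Finset.measurableSet_biUnion _ fun a _ => measurableSet_comp_eq hq a
  rw [← measureReal_restrict_apply hT,
    ← sum_measureReal_preimage_singleton _ fun a _ => measurableSet_comp_eq hq a, Finset.sum_div]
  refine Finset.sum_congr rfl fun x _ => ?_
  rw [cellLaw, measureReal_restrict_apply (measurableSet_comp_eq hq x)]

/-- On average over the points of `S`, few edges have cells in `Q`, if edges of points of `S` lie
in `P` and `Q` approximates the complement of `P`. -/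
theorem sum_sum_cellLaw_le {E : Finset (U ↪ V)} {k : ℕ} (hk : 0 < k)
    (hdeg : ∀ v, (E.filter (fun φ => ∃ i, φ i = v)).card = k)
    {P : Set (U → X)} (hP : NullMeasurableSet P (Measure.pi fun _ : U => μ)) {q : X → K}
    (hq : ∀ a, MeasurableSet (q ⁻¹' {a})) {Q : Finset (U → K)} {ε l : ℝ}
    (hQ : (Measure.pi fun _ : U => μ).real ({c | q ∘ c ∈ Q} ∆ Pᶜ) ≤ ε) (hl : 0 < l)
    {S : Set (V → X)} (hSP : ∀ c ∈ S, ∀ φ ∈ E, c ∘ φ ∈ P)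
    (hS : 0 < (Measure.pi fun _ : V => μ).real S) :
    ∑ φ ∈ E, ∑ x, cellLaw (Measure.pi fun _ : V => μ) S q x * (if x ∘ φ ∈ Q then 1 else 0) ≤
      k / l * (-Real.log ((Measure.pi fun _ : V => μ).real S) + Real.exp l * ε * E.card / k) := by
  set m := Measure.pi fun _ : V => μ with hm
  obtain ⟨P', hPP', hP'm, hP'⟩ := hP.exists_measurable_superset_ae_eq
  -- Edges of points of S lie in P, so they are coloured from Q only inside this error set of
  -- measure at most ε.
  let B : Set (U → X) := {c | q ∘ c ∈ Q} ∩ P'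
  have hQm : MeasurableSet {c : U → X | q ∘ c ∈ Q} := by
    have : {c : U → X | q ∘ c ∈ Q} = ⋃ a ∈ Q, (fun c : U → X => q ∘ c) ⁻¹' {a} := by
      ext; simp
    rw [this]
    exact Finset.measurableSet_biUnion _ fun a _ => measurableSet_comp_eq hq a
  have hB : MeasurableSet B := hQm.inter hP'm
  have hBε : (Measure.pi fun _ : U => μ).real B ≤ ε := by
    refine le_trans ?_ hQ
    rw [measureReal_congr (t := {c : U → X | q ∘ c ∈ Q} ∩ P)
      ((ae_eq_refl _).inter hP')]
    refine measureReal_mono ?_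
    rintro c ⟨hc, hcP⟩
    exact Or.inl ⟨hc, fun h => h hcP⟩
  have hmain := sum_measureReal_inter_le (μ := μ) (l := l) hk hdeg hB hBε S hS
  have hk' : (0 : ℝ) < k := by exact_mod_cast hk
  have hterm : ∀ φ ∈ E, ∑ x, cellLaw m S q x * (if x ∘ φ ∈ Q then 1 else 0) =
      m.real ({c | c ∘ φ ∈ B} ∩ S) / m.real S := by
    intro φ hφ
    simp only [mul_ite, mul_one, mul_zero]
    rw [← Finset.sum_filter, sum_cellLaw_filter hq]
    congr 2
    ext c
    simp only [Set.mem_inter_iff, Set.mem_preimage, Finset.coe_filter, Set.mem_ofPred_eq,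
      mem_univ, true_and, B]
    constructor
    · rintro ⟨h1, h2⟩
      exact ⟨⟨h1, hPP' (hSP c h2 φ hφ)⟩, h2⟩
    · rintro ⟨⟨h1, -⟩, h2⟩
      exact ⟨h1, h2⟩
  rw [Finset.sum_congr rfl hterm, ← Finset.sum_div, div_le_iff₀ hS]
  have h2 := mul_le_mul_of_nonneg_left hmain (by positivity : 0 ≤ k / l)
  calc _ = k / l * (l / k * ∑ φ ∈ E, m.real ({c | c ∘ φ ∈ B} ∩ S)) := by field_simp
    _ ≤ _ := h2
    _ = _ := by ring

end Cells

/-! ### Volume bound with explicit parameters. -/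

section VolumeBound

open scoped symmDiff
open Finset

variable {U V X K : Type*} [Fintype U] [Fintype V] [Fintype K] [DecidableEq U] [DecidableEq V]
  [DecidableEq K] [MeasurableSpace X] {μ : Measure X} [IsProbabilityMeasure μ]

/-- Volume bound for a set all of whose edges lie in `P`, in terms of the volumes of the boxes that
are nearly contained in `P`. -/
theorem measureReal_le_of_regular {E : Finset (U ↪ V)} {k : ℕ} {θ κ m η c τ l γ ε : ℝ}
    {P : Set (U → X)} {S : Set (V → X)} {q : X → K} {Q : Finset (U → K)}
    (hθ : 0 < θ) (hθ1 : θ < 1) (hk : 0 < k)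
    (hdeg : ∀ v, (E.filter (fun φ => ∃ i, φ i = v)).card = k) (hU : 0 < Fintype.card U)
    (hP : NullMeasurableSet P (Measure.pi fun _ : U => μ)) (hκ : 0 < κ) (hm : 0 ≤ m) (hη : 0 ≤ η)
    (hc : 0 < c) (hτ : 0 ≤ τ) (hl : 0 < l)
    (hbox : ∀ A : U → Set X, (∀ i, MeasurableSet (A i)) →
      Measure.pi (fun _ : U => μ) (Set.univ.pi A \ P) ≤ ENNReal.ofReal κ →
      Measure.pi (fun _ : U => μ) (Set.univ.pi A) < ENNReal.ofReal (Real.exp (-m)))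
    (hq : ∀ a, MeasurableSet (q ⁻¹' {a}))
    (hQ : (Measure.pi fun _ : U => μ).real ({c | q ∘ c ∈ Q} ∆ Pᶜ) ≤ ε)
    (hεκ : ε ≤ κ / 2) (hεl : Real.exp l * ε ≤ 1) (hlγ : (m + 1) / l ≤ γ)
    (hfrac : Fintype.card U / c + (κ / 2 * θ ^ Fintype.card U)⁻¹ *
      (γ + (Fintype.card K : ℝ) ^ Fintype.card U * √(Fintype.card U * τ)) ≤ θ)
    (hθη : m / Fintype.card U - η ≤ (1 - θ) * (m / Fintype.card U) * (1 - θ) +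
      (Real.log (1 - θ) + θ * Real.log θ))
    (hSP : ∀ c ∈ S, ∀ φ ∈ E, c ∘ φ ∈ P) (M : ℕ)
    (hM : c * Fintype.card V * (M + 1 : ℝ)⁻¹ * ((k : ℝ) ^ 2 * Fintype.card V +
          (M + 1 : ℝ) ^ (2 * (Fintype.card U - 1)) *
          (Fintype.card U * (((E ×ˢ E).filter fun p => 1 < (univ.map p.1 ∩ univ.map p.2).card ∧
              (univ.map p.1 ∩ univ.map p.2).card < Fintype.card U).card +
            E.card * (Fintype.card U : ℝ) ^ Fintype.card U))) ≤ (τ * E.card) ^ 2) :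
    (Measure.pi fun _ : V => μ).real S ≤
      Real.exp (-(m / Fintype.card U - η) * Fintype.card V) := by
  have hr : (0 : ℝ) < Fintype.card U := by exact_mod_cast hU
  have hk' : (0 : ℝ) < k := by exact_mod_cast hk
  -- If S is this small the claim already holds. Otherwise -log vol(S) is at most m|V|/r, which the
  -- exponential moment bound needs in order to make edges coloured from Q rare.
  by_cases hsmall : (Measure.pi fun _ : V => μ).real S ≤
      Real.exp (-(m / Fintype.card U) * Fintype.card V)
  · refine hsmall.trans (Real.exp_le_exp.2 ?_)
    have hd0 : (0 : ℝ) ≤ Fintype.card V := Nat.cast_nonneg _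
    nlinarith
  push Not at hsmall
  have hW0 : 0 < (Measure.pi fun _ : V => μ).real S := (Real.exp_pos _).trans hsmall
  have hlogW : -Real.log ((Measure.pi fun _ : V => μ).real S) ≤
      m / Fintype.card U * Fintype.card V := by
    have := Real.log_le_log (Real.exp_pos _) hsmall.le
    rw [Real.log_exp] at this
    linarith
  have hcard := card_mul_card_eq hdeg
  have hδ := sum_sum_cellLaw_le (μ := μ) hk hdeg hP hq hQ hl hSP hW0
  have hδ' : k / l * (-Real.log ((Measure.pi fun _ : V => μ).real S) +
      Real.exp l * ε * E.card / k) ≤ γ * E.card := by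
    calc _ ≤ k / l * (m / Fintype.card U * Fintype.card V + 1 * E.card / k) := by gcongr
      _ = (m / Fintype.card U * (k * Fintype.card V) + E.card) / l := by field_simp
      _ = (m + 1) / l * E.card := by rw [← hcard]; field_simp
      _ ≤ γ * E.card := by gcongr
  have hmain := neg_log_ge_of_regular (μ := cellLaw (Measure.pi fun _ : V => μ) S q)
    (p := fun a => μ.real (q ⁻¹' {a}))
    (fun x => div_nonneg measureReal_nonneg measureReal_nonneg)
    (by
      rw [sum_cellLaw_filter hq]
      simp only [Finset.coe_univ, Set.preimage_univ, Set.univ_inter]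
      exact div_self hW0.ne')
    (fun a => measureReal_nonneg) (sum_measureReal_cell hq) hθ hθ1 hW0
    (fun x => by
      rw [cellLaw, mul_div_cancel₀ _ hW0.ne']
      refine (measureReal_mono Set.inter_subset_left).trans (le_of_eq ?_)
      exact measureReal_comp_eq q x)
    hk hdeg hU (half_pos hκ) hm hc hτ
    (fun A hA => prod_sum_cell_le hbox hq (hQ.trans hεκ) A hA) (hδ.trans hδ') M hM
  have hfinal : (m / Fintype.card U - η) * Fintype.card V ≤
      -Real.log ((Measure.pi fun _ : V => μ).real S) := by
    refine le_trans ?_ hmain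
    rw [mul_comm]
    refine mul_le_mul_of_nonneg_left ?_ (Nat.cast_nonneg _)
    refine hθη.trans ?_
    have h1 : 0 ≤ (1 - θ) * (m / Fintype.card U) := mul_nonneg (by linarith) (by positivity)
    refine add_le_add_left (mul_le_mul_of_nonneg_left ?_ h1) _
    linarith
  rw [← Real.exp_log hW0]
  refine Real.exp_le_exp.2 ?_
  linarith

end VolumeBound

/-! ### Application to good homogeneous ssees. -/

namespace SSEE

theorem DecorationProperty.IsHereditary.comp_mem {S : SSEE.{u}} {P : S.DecorationProperty} (hP : P.IsHereditary)
    {N n : ℕ} (hNn : N ≤ n) {c : S.Decoration n} (hc : c ∈ P.body n) {φ : S.V N ↪ S.V n}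
    (hφ : φ ∈ S.emb N n) : c ∘ φ ∈ P.body N := by
  by_contra h
  refine hP N n hNn ?_ hc
  exact Set.mem_iUnion₂.2 ⟨φ, hφ, c ∘ φ, h, fun i => rfl⟩

theorem IsHomogeneous.exists_degree {S : SSEE.{u}} (hS : S.IsHomogeneous) {N n : ℕ} (hNn : N ≤ n)
    (hN : 0 < Fintype.card (S.V N)) [DecidableEq (S.V n)] :
    ∃ k : ℕ, 0 < k ∧
      (∀ v : S.V n, ((S.emb N n).filter (fun φ => ∃ i, φ i = v)).card = k) ∧
      (Fintype.card (S.V N) : ℝ) * (S.emb N n).card = k * Fintype.card (S.V n) := by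
  classical
  obtain ⟨k, hk, h⟩ := hS N n hNn (Fintype.card_pos_iff.1 hN)
  suffices hdeg : ∀ v : S.V n, ((S.emb N n).filter (fun φ => ∃ i, φ i = v)).card = k from
    ⟨k, hk, hdeg, card_mul_card_eq hdeg⟩
  intro v
  rw [← h v, ← Set.ncard_coe_finset]
  congr 1
  ext φ
  simp

theorem totalIntersecting_eq (S : SSEE.{u}) (N n : ℕ) [DecidableEq (S.V n)] :
    S.totalIntersecting N n = ((S.emb N n ×ˢ S.emb N n).filter fun p =>
      1 < (Finset.univ.map p.1 ∩ Finset.univ.map p.2).card ∧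
      (Finset.univ.map p.1 ∩ Finset.univ.map p.2).card < Fintype.card (S.V N)).card := by
  rw [totalIntersecting, Finset.card_eq_sum_card_fiberwise
    (f := fun p => (Finset.univ.map p.1 ∩ Finset.univ.map p.2).card)
    (t := Finset.Ioo 1 (Fintype.card (S.V N))) (fun p hp => by
      simpa using (Finset.mem_filter.1 hp).2)]
  refine Finset.sum_congr rfl fun i hi => ?_
  rw [intersecting, ← Set.ncard_coe_finset]
  congr 1
  ext p
  have : (Set.range p.1 ∩ Set.range p.2).ncard =
      (Finset.univ.map p.1 ∩ Finset.univ.map p.2).card := by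
    rw [← Set.ncard_coe_finset]
    congr 1
    simp
  rw [Finset.mem_Ioo] at hi
  simp only [Set.mem_ofPred_eq, this, Finset.coe_filter, Finset.mem_filter, Finset.mem_product]
  constructor
  · rintro ⟨h1, h2, h3⟩
    exact ⟨⟨⟨h1, h2⟩, by rw [h3]; exact hi⟩, h3⟩
  · rintro ⟨⟨⟨h1, h2⟩, -⟩, h3⟩
    exact ⟨h1, h2, h3⟩

/-- In a good homogeneous ssee the error term of the pinning argument is eventually small. -/
theorem IsGood.eventually_pinning_le {S : SSEE.{u}} (hgood : S.IsGood) {N : ℕ}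
    (hN : 1 < Fintype.card (S.V N)) {c τ : ℝ} (M : ℕ)
    (hM : c * (M + 1 : ℝ)⁻¹ * (Fintype.card (S.V N) : ℝ) ^ 2 < τ ^ 2) :
    ∀ᶠ n in atTop, ∀ k : ℕ,
      (Fintype.card (S.V N) : ℝ) * (S.emb N n).card = k * Fintype.card (S.V n) →
      c * Fintype.card (S.V n) * (M + 1 : ℝ)⁻¹ * ((k : ℝ) ^ 2 * Fintype.card (S.V n) +
        (M + 1 : ℝ) ^ (2 * (Fintype.card (S.V N) - 1)) *
          (Fintype.card (S.V N) * (S.totalIntersecting N n +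
            (S.emb N n).card * (Fintype.card (S.V N) : ℝ) ^ Fintype.card (S.V N)))) ≤
        (τ * (S.emb N n).card) ^ 2 := by
  set r := Fintype.card (S.V N) with hr
  set L : ℝ := (M + 1 : ℝ) with hL
  have h1 := hgood.many_embeddings N hN
  have h2 := hgood.few_intersections N hN
  have hlim : Tendsto (fun n => c * L⁻¹ * ((r : ℝ) ^ 2 + L ^ (2 * (r - 1)) * (r *
      (((Fintype.card (S.V n) : ℝ) * (S.totalIntersecting N n : ℝ)) / ((S.emb N n).card : ℝ) ^ 2 +
        (((S.emb N n).card : ℝ) / (Fintype.card (S.V n) : ℝ))⁻¹ * (r : ℝ) ^ r)))) atTop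
      (𝓝 (c * L⁻¹ * ((r : ℝ) ^ 2 + L ^ (2 * (r - 1)) * (r * (0 + 0 * (r : ℝ) ^ r))))) :=
    Tendsto.const_mul _ (Tendsto.const_add _ (Tendsto.const_mul _ (Tendsto.const_mul _
      (h2.add (h1.inv_tendsto_atTop.mul_const _)))))
  have hlt : c * L⁻¹ * ((r : ℝ) ^ 2 + L ^ (2 * (r - 1)) * (r * (0 + 0 * (r : ℝ) ^ r))) < τ ^ 2 := by
    -- Both goodness ratios vanish in the limit, leaving only c r²/L: since r|E| = k|V|, the main
    -- term k²|V|² is r²|E|².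
    simpa using hM
  filter_upwards [hlim.eventually_lt_const hlt, h1.eventually_gt_atTop 0] with n hn hpos k hk
  have hV : (Fintype.card (S.V n) : ℝ) ≠ 0 := fun h => by simp [h] at hpos
  have hE : ((S.emb N n).card : ℝ) ≠ 0 := fun h => by simp [h] at hpos
  set E : ℝ := ((S.emb N n).card : ℝ)
  set d : ℝ := (Fintype.card (S.V n) : ℝ)
  set I : ℝ := (S.totalIntersecting N n : ℝ)
  have hE2 : 0 < E ^ 2 := by positivity
  have h3 := mul_le_mul_of_nonneg_right hn.le hE2.le
  rw [← mul_pow] at h3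
  refine le_trans (le_of_eq ?_) h3
  have e1 : (r : ℝ) ^ 2 * E ^ 2 = k ^ 2 * d ^ 2 := by
    rw [← mul_pow, hk, mul_pow]
  have e2 : (d * I / E ^ 2) * E ^ 2 = d * I := by field_simp
  have e3 : (E / d)⁻¹ * E ^ 2 = d * E := by field_simp
  linear_combination (-(c * L⁻¹)) * e1 - (c * L⁻¹ * L ^ (2 * (r - 1)) * r) * e2 -
    (c * L⁻¹ * L ^ (2 * (r - 1)) * r * (r : ℝ) ^ r) * e3

theorem volume_box_lt {S : SSEE.{u}} {P : S.DecorationProperty} {N : ℕ} {m : ℝ}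
    (hm : (m : EReal) < S.extremalEntropy P N) (A : S.V N → Set unitInterval)
    (hA : ∀ i, MeasurableSet (A i))
    (hAP : volume (Set.univ.pi A \ P.body N) = 0) :
    volume (Set.univ.pi A) < ENNReal.ofReal (Real.exp (-m)) := by
  have h1 : S.extremalEntropy P N ≤ S.entropy (Set.univ.pi A) :=
    sInf_le ⟨_, ⟨A, fun i => (hA i).nullMeasurableSet, rfl⟩, hAP, rfl⟩
  have h2 := hm.trans_le h1
  rw [entropy, EReal.lt_neg_comm] at h2
  rw [← ENNReal.log_lt_log_iff, ENNReal.log_ofReal_of_pos (Real.exp_pos _), Real.log_exp]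
  simpa using h2

/-- Continuity at θ = 0, where θ log θ takes the value 0 by the convention for log 0. -/
theorem exists_small_parameter {a η : ℝ} (hη : 0 < η) :
    ∃ θ : ℝ, 0 < θ ∧ θ < 1 ∧
      a - η < (1 - θ) * a * (1 - θ) + (Real.log (1 - θ) + θ * Real.log θ) := by
  have hcont : ContinuousAt
      (fun θ : ℝ => (1 - θ) * a * (1 - θ) + (Real.log (1 - θ) + θ * Real.log θ)) 0 := by
    refine ContinuousAt.add (by fun_prop) (ContinuousAt.add ?_ Real.continuous_mul_log.continuousAt)
    exact ContinuousAt.log (by fun_prop) (by norm_num)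
  have h0 : a - η <
      (1 - (0 : ℝ)) * a * (1 - 0) + (Real.log (1 - 0) + 0 * Real.log 0) := by
    simp [hη]
  have h1 : ∀ᶠ θ in 𝓝[>] (0 : ℝ),
      a - η < (1 - θ) * a * (1 - θ) + (Real.log (1 - θ) + θ * Real.log θ) :=
    (hcont.eventually_const_lt h0).filter_mono nhdsWithin_le_nhds
  have h2 : ∀ᶠ θ in 𝓝[>] (0 : ℝ), θ < 1 :=
    (eventually_lt_nhds zero_lt_one).filter_mono nhdsWithin_le_nhds
  obtain ⟨θ, hθ, hθ1, hθ0⟩ := (h1.and (h2.and self_mem_nhdsWithin)).exists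
  exact ⟨θ, hθ0, hθ1, hθ⟩

theorem eventually_regular {S : SSEE.{u}} (hgood : S.IsGood) (hhom : S.IsHomogeneous) {N : ℕ}
    (hN : 1 < Fintype.card (S.V N)) [∀ n, DecidableEq (S.V n)] {c τ : ℝ} (M : ℕ)
    (hM : c * (M + 1 : ℝ)⁻¹ * (Fintype.card (S.V N) : ℝ) ^ 2 < τ ^ 2) :
    ∀ᶠ n in atTop, N ≤ n ∧ ∃ k : ℕ, 0 < k ∧
      (∀ v : S.V n, ((S.emb N n).filter (fun φ => ∃ i, φ i = v)).card = k) ∧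
      c * Fintype.card (S.V n) * (M + 1 : ℝ)⁻¹ * ((k : ℝ) ^ 2 * Fintype.card (S.V n) +
        (M + 1 : ℝ) ^ (2 * (Fintype.card (S.V N) - 1)) *
          (Fintype.card (S.V N) * (((S.emb N n ×ˢ S.emb N n).filter fun p =>
              1 < (Finset.univ.map p.1 ∩ Finset.univ.map p.2).card ∧
              (Finset.univ.map p.1 ∩ Finset.univ.map p.2).card < Fintype.card (S.V N)).card +
            (S.emb N n).card * (Fintype.card (S.V N) : ℝ) ^ Fintype.card (S.V N)))) ≤
        (τ * (S.emb N n).card) ^ 2 := by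
  filter_upwards [hgood.eventually_pinning_le hN M hM, eventually_ge_atTop N] with n hn hNn
  obtain ⟨k, hk, hdeg, hcard⟩ := hhom.exists_degree hNn (zero_lt_one.trans hN)
  refine ⟨hNn, k, hk, hdeg, ?_⟩
  rw [← totalIntersecting_eq]
  exact hn k hcard

/-- The extremal entropy of a hereditary property at a fixed index bounds the volume of the
property at all large indices. -/
theorem eventually_volume_le {S : SSEE.{u}} (hgood : S.IsGood) (hhom : S.IsHomogeneous)
    {P : S.DecorationProperty} (hP : P.IsHereditary) {N : ℕ} (hN : 1 < Fintype.card (S.V N))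
    {m η : ℝ} (hm0 : 0 ≤ m) (hη : 0 < η) (hm : (m : EReal) < S.extremalEntropy P N) :
    ∀ᶠ n in atTop, volume (P.body n) ≤
      ENNReal.ofReal (Real.exp (-(m / Fintype.card (S.V N) - η) * Fintype.card (S.V n))) := by
  classical
  have hr : (0 : ℝ) < Fintype.card (S.V N) := by exact_mod_cast (by omega)
  -- The order of choices matters: η fixes θ; P_N and m fix κ; these fix γ, l and ε; ε fixes the
  -- partition K; only then can τ beat the power of |K|, and finally M beats c r²/τ². In `hfrac` the
  -- pinned set and the two sources of Q-coloured edges cost θ/3 each.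
  obtain ⟨θ, hθ, hθ1, hθη⟩ := exists_small_parameter (a := m / Fintype.card (S.V N)) hη
  obtain ⟨κ, hκ, hbox⟩ := exists_pos_forall_box_lt (μ := (volume : Measure unitInterval))
    (P.measurable_body N) (volume_box_lt hm)
  obtain ⟨γ, hγ0, hγ⟩ : ∃ γ : ℝ, 0 < γ ∧
      γ = κ / 2 * θ ^ Fintype.card (S.V N) * (θ / 3) := ⟨_, by positivity, rfl⟩
  obtain ⟨l, hl0, hl⟩ : ∃ l : ℝ, 0 < l ∧ (m + 1) / l ≤ γ :=
    ⟨(m + 1) / γ, by positivity, le_of_eq (by field_simp)⟩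
  obtain ⟨ε, hε0, hεκ, hεl⟩ : ∃ ε : ℝ, 0 < ε ∧ ε ≤ κ / 2 ∧ Real.exp l * ε ≤ 1 := by
    refine ⟨min (κ / 2) (Real.exp (-l)), lt_min (by positivity) (Real.exp_pos _),
      min_le_left _ _, ?_⟩
    calc _ ≤ Real.exp l * Real.exp (-l) := by
          gcongr; exact min_le_right _ _
      _ = 1 := by rw [← Real.exp_add]; simp
  obtain ⟨K, hK, q, Q', hq, hQ'⟩ := exists_finite_partition_approx
    (volume : Measure (S.Decoration N)) (P.measurable_body N).compl (ENNReal.ofReal_pos.2 hε0)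
  obtain ⟨Q, rfl⟩ : ∃ Q : Finset (S.V N → K), (Q : Set (S.V N → K)) = Q' :=
    ⟨Q'.toFinset, Set.coe_toFinset _⟩
  have hQ : (volume : Measure (S.Decoration N)).real
      (symmDiff {c | q ∘ c ∈ Q} (P.body N)ᶜ) ≤ ε :=
    ENNReal.toReal_le_of_le_ofReal hε0.le hQ'.le
  obtain ⟨c, hc0, hc⟩ : ∃ c : ℝ, 0 < c ∧ Fintype.card (S.V N) / c = θ / 3 :=
    ⟨3 * Fintype.card (S.V N) / θ, by positivity, by field_simp⟩
  obtain ⟨τ, hτ0, hτ⟩ : ∃ τ : ℝ, 0 < τ ∧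
      (Fintype.card K : ℝ) ^ Fintype.card (S.V N) * √(Fintype.card (S.V N) * τ) ≤ γ := by
    refine ⟨(γ / ((Fintype.card K : ℝ) ^ Fintype.card (S.V N) + 1)) ^ 2 / Fintype.card (S.V N),
      by positivity, ?_⟩
    rw [mul_div_cancel₀ _ hr.ne', Real.sqrt_sq (by positivity), ← mul_div_assoc,
      div_le_iff₀ (by positivity)]
    nlinarith
  obtain ⟨M, hM⟩ : ∃ M : ℕ, c * (M + 1 : ℝ)⁻¹ * (Fintype.card (S.V N) : ℝ) ^ 2 < τ ^ 2 := by
    obtain ⟨M, hM⟩ := exists_nat_gt (c * (Fintype.card (S.V N) : ℝ) ^ 2 / τ ^ 2)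
    refine ⟨M, ?_⟩
    rw [div_lt_iff₀ (by positivity)] at hM
    rw [mul_right_comm, ← div_eq_mul_inv, div_lt_iff₀ (by positivity)]
    nlinarith [sq_nonneg τ]
  have hfrac : Fintype.card (S.V N) / c + (κ / 2 * θ ^ Fintype.card (S.V N))⁻¹ *
      (γ + (Fintype.card K : ℝ) ^ Fintype.card (S.V N) * √(Fintype.card (S.V N) * τ)) ≤ θ := by
    have h2 : (κ / 2 * θ ^ Fintype.card (S.V N))⁻¹ *
        (γ + (Fintype.card K : ℝ) ^ Fintype.card (S.V N) * √(Fintype.card (S.V N) * τ)) ≤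
        (κ / 2 * θ ^ Fintype.card (S.V N))⁻¹ * (γ + γ) := by gcongr
    have h3 : (κ / 2 * θ ^ Fintype.card (S.V N))⁻¹ * (γ + γ) = 2 * (θ / 3) := by
      rw [hγ]; field_simp; ring
    linarith
  filter_upwards [eventually_regular hgood hhom hN M hM] with n hn
  obtain ⟨hNn, k, hk, hdeg, hn'⟩ := hn
  have key := measureReal_le_of_regular (μ := (volume : Measure unitInterval)) (S := P.body n)
    hθ hθ1 hk hdeg (zero_lt_one.trans hN) (P.measurable_body N) hκ hm0 hη.le hc0 hτ0.le hl0 hbox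
    hq hQ hεκ hεl hl hfrac hθη.le
    (fun c hc φ hφ => hP.comp_mem hNn hc hφ) M hn'
  exact (ENNReal.le_ofReal_iff_toReal_le (measure_ne_top _ _) (Real.exp_pos _).le).2 key

theorem entropy_body_le (S : SSEE.{u}) (P : S.DecorationProperty) (n : ℕ) :
    S.entropy (P.body n) ≤ S.extremalEntropy P n := by
  refine le_sInf ?_
  rintro e ⟨b, -, hb, rfl⟩
  rw [entropy, entropy, EReal.neg_le_neg_iff, ENNReal.log_le_log_iff]
  exact measure_mono_ae (ae_le_set.2 hb)

theorem entropy_nonneg (S : SSEE.{u}) {n : ℕ} (b : Set (S.Decoration n)) : 0 ≤ S.entropy b := by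
  rw [entropy, EReal.le_neg, neg_zero, ENNReal.log_le_zero_iff]
  exact prob_le_one

theorem entropy_div_card (S : SSEE.{u}) {n : ℕ} {b : Set (S.Decoration n)} (hb : volume b ≠ 0) :
    S.entropy b / (Fintype.card (S.V n) : EReal) =
      ((-Real.log (volume b).toReal / (Fintype.card (S.V n) : ℝ) : ℝ) : EReal) := by
  rw [entropy, ENNReal.log_pos_real hb (measure_ne_top _ _), EReal.coe_div, EReal.coe_neg]
  rfl

theorem eventually_le_entropy_div {S : SSEE.{u}} (hgood : S.IsGood) (hhom : S.IsHomogeneous)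
    {P : S.DecorationProperty} (hP : P.IsHereditary) {N : ℕ} (hN : 1 < Fintype.card (S.V N))
    {c : EReal} (hc : c < S.extremalEntropy P N / (Fintype.card (S.V N) : EReal)) :
    ∀ᶠ n in atTop, c ≤ S.entropy (P.body n) / (Fintype.card (S.V n) : EReal) := by
  obtain ⟨d, hcd, hd⟩ := EReal.lt_iff_exists_real_btwn.1 hc
  by_cases hd0 : d ≤ 0
  · refine Eventually.of_forall fun n => hcd.le.trans ?_
    refine le_trans (by exact_mod_cast hd0) (EReal.div_nonneg (S.entropy_nonneg _) ?_)
    exact_mod_cast Nat.zero_le _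
  push Not at hd0
  -- A second real number leaves room for the loss η = d' - d.
  obtain ⟨d', hdd', hd'⟩ := EReal.lt_iff_exists_real_btwn.1 hd
  have hdd'' : d < d' := by exact_mod_cast hdd'
  have hr : (0 : ℝ) < Fintype.card (S.V N) := by exact_mod_cast (by omega)
  have hm : ((d' * Fintype.card (S.V N) : ℝ) : EReal) < S.extremalEntropy P N := by
    rw [EReal.lt_div_iff (by exact_mod_cast (by omega)) (EReal.natCast_ne_top _)] at hd'
    rw [EReal.coe_mul]
    exact hd'
  have hev := eventually_volume_le hgood hhom hP hN (m := d' * Fintype.card (S.V N))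
    (η := d' - d) (by nlinarith) (by linarith) hm
  filter_upwards [hev, hgood.card_tendsto.eventually_gt_atTop 0] with n hn hpos
  refine hcd.le.trans ?_
  rw [EReal.le_div_iff_mul_le (by exact_mod_cast hpos) (EReal.natCast_ne_top _)]
  have h1 : d' * Fintype.card (S.V N) / Fintype.card (S.V N) - (d' - d) = d := by
    field_simp; ring
  rw [h1, ← ENNReal.log_le_log_iff, ENNReal.log_ofReal_of_pos (Real.exp_pos _),
    Real.log_exp] at hn
  rw [entropy, EReal.le_neg]
  refine hn.trans (le_of_eq ?_)
  rw [neg_mul, EReal.coe_neg, EReal.coe_mul]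
  rfl

end SSEE

theorem mainTheorem3 (S : SSEE.{u}) (hgood : S.IsGood) (hhom : S.IsHomogeneous)
    (P : S.DecorationProperty) (hP : P.IsHereditary) :
    (∃ π : ℝ,
      Tendsto (fun n => S.extremalEntropy P n / (Fintype.card (S.V n) : EReal)) atTop
        (𝓝 (π : EReal)) ∧
      ∃ ε : ℕ → ℝ, Tendsto ε atTop (𝓝 0) ∧
        ∀ᶠ n in atTop, volume (P.body n) =
          ENNReal.ofReal (Real.exp (-(π + ε n) * (Fintype.card (S.V n) : ℝ)))) ∨
    (Tendsto (fun n => S.extremalEntropy P n / (Fintype.card (S.V n) : EReal)) atTop (𝓝 ⊤) ∧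
      ∃ w : ℕ → ℝ, Tendsto (fun n => w n / (Fintype.card (S.V n) : ℝ)) atTop atTop ∧
        ∀ᶠ n in atTop, volume (P.body n) ≤ ENNReal.ofReal (Real.exp (-w n))) := by
  set a : ℕ → EReal := fun n => S.extremalEntropy P n / (Fintype.card (S.V n) : EReal) with ha
  set b : ℕ → EReal := fun n => S.entropy (P.body n) / (Fintype.card (S.V n) : EReal) with hb
  have hcard : ∀ n, (0 : EReal) ≤ (Fintype.card (S.V n) : EReal) := fun n => by
    exact_mod_cast Nat.zero_le _
  have hba : ∀ n, b n ≤ a n := fun n =>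
    EReal.div_le_div_right_of_nonneg (hcard n) (S.entropy_body_le P n)
  have hb0 : ∀ n, 0 ≤ b n := fun n => EReal.div_nonneg (S.entropy_nonneg _) (hcard n)
  have hpos := hgood.card_tendsto.eventually_gt_atTop 0
  -- A single index N with large normalized extremal entropy controls all large n, so no
  -- monotonicity in n is needed. Such an N can be taken with |V_N| > 1 since |V_n| → ∞.
  have hinf : limsup a atTop ≤ liminf b atTop := by
    refine le_of_forall_lt_imp_le_of_dense fun c hc => ?_
    obtain ⟨N, hN, hN1⟩ := ((frequently_lt_of_lt_limsup (by isBoundedDefault) hc).and_eventually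
      (hgood.card_tendsto.eventually_gt_atTop 1)).exists
    exact le_liminf_of_le (by isBoundedDefault)
      (SSEE.eventually_le_entropy_div hgood hhom hP hN1 hN)
  have hblim : Tendsto b atTop (𝓝 (limsup a atTop)) :=
    tendsto_of_le_liminf_of_limsup_le hinf (limsup_le_limsup (Eventually.of_forall hba))
  have halim : Tendsto a atTop (𝓝 (limsup a atTop)) :=
    tendsto_of_le_liminf_of_limsup_le
      (hinf.trans (liminf_le_liminf (Eventually.of_forall hba))) le_rfl
  have hπ0 : 0 ≤ limsup a atTop := ge_of_tendsto hblim (Eventually.of_forall hb0)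
  have hbtop : ∀ n, 0 < Fintype.card (S.V n) → volume (P.body n) = 0 → b n = ⊤ := by
    intro n hn h0
    simp only [hb, SSEE.entropy, h0, ENNReal.log_zero, EReal.neg_bot]
    exact EReal.top_div_of_pos_ne_top (by exact_mod_cast hn) (EReal.natCast_ne_top _)
  generalize limsup a atTop = π at *
  induction π using EReal.rec with
  | bot => simp at hπ0
  | coe π =>
    left
    refine ⟨π, halim, fun n => -Real.log (volume (P.body n)).toReal /
      (Fintype.card (S.V n) : ℝ) - π, ?_, ?_⟩
    · have hne : ∀ᶠ n in atTop, volume (P.body n) ≠ 0 := by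
        filter_upwards [hblim.eventually_lt_const (EReal.coe_lt_top π), hpos] with n hn hn0 h0
        exact hn.ne (hbtop n hn0 h0)
      have hreal : Tendsto (fun n => -Real.log (volume (P.body n)).toReal /
          (Fintype.card (S.V n) : ℝ)) atTop (𝓝 π) := by
        rw [← EReal.tendsto_coe]
        refine hblim.congr' ?_
        filter_upwards [hne] with n hn
        exact S.entropy_div_card hn
      simpa using hreal.sub_const π
    · filter_upwards [hblim.eventually_lt_const (EReal.coe_lt_top π), hpos] with n hn hn0
      have hne : volume (P.body n) ≠ 0 := fun h0 => hn.ne (hbtop n hn0 h0)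
      have hfin : volume (P.body n) ≠ ⊤ := measure_ne_top _ _
      have hd : (Fintype.card (S.V n) : ℝ) ≠ 0 := by exact_mod_cast hn0.ne'
      have : -(π + (-Real.log (volume (P.body n)).toReal / (Fintype.card (S.V n) : ℝ) - π)) *
          (Fintype.card (S.V n) : ℝ) = Real.log (volume (P.body n)).toReal := by
        field_simp
        ring
      rw [this, Real.exp_log (ENNReal.toReal_pos hne hfin), ENNReal.ofReal_toReal hfin]
  | top =>
    right
    -- On null sets any superlinear value of w is admissible; n|V_n| is taken there, since the real
    -- logarithm of 0 would give 0.
    refine ⟨halim, fun n => if volume (P.body n) = 0 then n * (Fintype.card (S.V n) : ℝ)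
      else -Real.log (volume (P.body n)).toReal, ?_, ?_⟩
    · refine tendsto_atTop.2 fun t => ?_
      filter_upwards [hblim.eventually_const_lt (EReal.coe_lt_top t), hpos,
        tendsto_natCast_atTop_atTop.eventually_ge_atTop t] with n hn hn0 hnt
      have hd : (Fintype.card (S.V n) : ℝ) ≠ 0 := by exact_mod_cast hn0.ne'
      split_ifs with h0
      · rwa [mul_div_assoc, div_self hd, mul_one]
      · simp only [hb] at hn
        rw [S.entropy_div_card h0] at hn
        exact (EReal.coe_lt_coe_iff.1 hn).le
    · refine Eventually.of_forall fun n => ?_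
      dsimp only
      split_ifs with h0
      · simp [h0]
      · have hfin : volume (P.body n) ≠ ⊤ := measure_ne_top _ _
        rw [neg_neg, Real.exp_log (ENNReal.toReal_pos h0 hfin), ENNReal.ofReal_toReal hfin]
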